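/- Let $I=[0,1]$ or $I=[0,\infty)$ with Lebesgue measure, and let $L^0(I)$ be the space of (classes of a.e. equal) real-valued measurable functions on $I$. A Banach function space on $I$ is a Banach space $X$ that is a linear subspace of $L^0(I)$ such that $f\in L^0(I)$, $g\in X$, $|f|\le|g|$ a.e. imply $f\in X$ and $\|f\|_X\le\|g\|_X$. For such $X$ put $$CX=\{f\in L^0(I): C|f|\in X\},\quad \|f\|_{CX}=\|C|f|\|_X,\quad C|f|(x)=\frac1x\int_0^x|f(t)|\,dt,$$ $$C^*X=\{f\in L^0(I): C^*|f|\in X\},\quad \|f\|_{C^*X}=\|C^*|f|\|_X,\quad C^*|f|(x)=\int_{I\cap[x,\infty)}\frac{|f(t)|}{t}\,dt,$$ $$\widetilde X=\{f\in L^0(I): \widetilde f\in X\},\quad \|f\|_{\widetilde X}=\|\widetilde f\|_X,\quad \widetilde f(x)=\operatorname*{ess\,sup}_{t\in I,\ t\ge x}|f(t)|,$$ and write $Ces_p(I)=C(L^p(I))$, $Cop_p(I)=C^*(L^p(I))$ for $1\le p\le\infty$. A normed space $E$ has the weak fixed point property if for every nonempty, weakly compact, convex set $K\subset E$ every map $T\colon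 K\to K$ with $\|Tx-Ty\|\le\|x-y\|$ for all $x,y\in K$ has a fixed point. Then the following spaces fail the weak fixed point property: 1. $Ces_1[0,1]$; 2. $Ces_\infty(I)$, $Cop_1(I)$ and $Cop_\infty(I)$, both for $I=[0,1]$ and for $I=[0,\infty)$; 3. $\widetilde X$, for every Banach function space $X$ on $I=[0,1]$ or $I=[0,\infty)$ with $\widetilde X\ne\{0\}$. -/

import Mathlib

open MeasureTheory Filter Topology Set
open scoped ENNReal

noncomputable section

/-- The two underlying intervals: `[0,1]` and `[0,∞)`. -/
inductive BaseInterval where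
  | unit : BaseInterval
  | halfLine : BaseInterval

namespace BaseInterval

/-- The interval as a set of real numbers. -/
def toSet : BaseInterval → Set ℝ
  | unit => Icc 0 1
  | halfLine => Ici 0

/-- Lebesgue measure on the interval. -/
abbrev measure (I : BaseInterval) : Measure ℝ := volume.restrict I.toSet

/-- `L⁰(I)`: classes of real-valued Lebesgue measurable functions on `I` modulo a.e. equality. -/
abbrev L0 (I : BaseInterval) : Type := ℝ →ₘ[I.measure] ℝ

end BaseInterval

open BaseInterval

/-- A Banach function space (Banach ideal space) on `I`: a linear subspace of `L⁰(I)` with a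
complete norm and the ideal property. No weak unit is required. -/
structure BanachFunctionSpace (I : BaseInterval) where
  /-- the elements of the space -/
  toSubmodule : Submodule ℝ I.L0
  /-- the norm of the space -/
  norm : toSubmodule → ℝ
  norm_nonneg : ∀ f, 0 ≤ norm f
  norm_smul : ∀ (c : ℝ) (f), norm (c • f) = |c| * norm f
  norm_add_le : ∀ f g, norm (f + g) ≤ norm f + norm g
  norm_eq_zero : ∀ f, norm f = 0 → f = 0
  complete : ∀ u : ℕ → toSubmodule,
    (∀ ε : ℝ, 0 < ε → ∃ N, ∀ m ≥ N, ∀ n ≥ N, norm (u m - u n) < ε) →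
      ∃ f, Tendsto (fun n => norm (u n - f)) atTop (𝓝 0)
  ideal_mem : ∀ f g : I.L0, (∀ᵐ x ∂I.measure, |f x| ≤ |g x|) →
    g ∈ toSubmodule → f ∈ toSubmodule
  ideal_norm_le : ∀ f g : toSubmodule,
    (∀ᵐ x ∂I.measure, |(f : I.L0) x| ≤ |(g : I.L0) x|) → norm f ≤ norm g

theorem coe_ae_congr_of_le {I : BaseInterval} {s : Set ℝ} {f g : ℝ → ℝ}
    (h : f =ᵐ[I.measure] g) (hs : s ⊆ I.toSet) : f =ᵐ[volume.restrict s] g :=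
  ae_mono (Measure.restrict_mono_set volume hs) h

/-- The Lebesgue space `L^p(I)`, `1 ≤ p ≤ ∞`, with its usual norm. -/
def lebesgueSpace (I : BaseInterval) (p : ℝ≥0∞) [Fact (1 ≤ p)] : BanachFunctionSpace I where
  toSubmodule := Lp.LpSubmodule ℝ ℝ p I.measure
  norm f := (eLpNorm (f : I.L0) p I.measure).toReal
  norm_nonneg _ := ENNReal.toReal_nonneg
  norm_smul c f := _root_.norm_smul c (show Lp ℝ p I.measure from ⟨f.1, f.2⟩)
  norm_add_le f g := _root_.norm_add_le (show Lp ℝ p I.measure from ⟨f.1, f.2⟩)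
    (show Lp ℝ p I.measure from ⟨g.1, g.2⟩)
  norm_eq_zero f h := by
    have h2 : (show Lp ℝ p I.measure from ⟨f.1, f.2⟩) = 0 := _root_.norm_eq_zero.mp h
    exact Subtype.ext (congrArg Subtype.val h2)
  complete u hu := by
    let v : ℕ → Lp ℝ p I.measure := fun n => ⟨(u n).1, (u n).2⟩
    have hv : CauchySeq v := by
      rw [Metric.cauchySeq_iff]
      intro ε hε
      obtain ⟨N, hN⟩ := hu ε hε
      refine ⟨N, fun m hm n hn => ?_⟩
      rw [dist_eq_norm]
      exact hN m hm n hn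
    obtain ⟨f, hf⟩ := cauchySeq_tendsto_of_complete hv
    exact ⟨⟨f.1, f.2⟩, tendsto_iff_norm_sub_tendsto_zero.mp hf⟩
  ideal_mem f g h hg := by
    have hg2 : eLpNorm g p I.measure < ∞ := Lp.mem_Lp_iff_eLpNorm_lt_top.mp hg
    exact Lp.mem_Lp_iff_eLpNorm_lt_top.mpr ((eLpNorm_mono_ae h).trans_lt hg2)
  ideal_norm_le f g h := by
    have hg2 : eLpNorm (g : I.L0) p I.measure < ∞ := Lp.mem_Lp_iff_eLpNorm_lt_top.mp g.2
    exact ENNReal.toReal_mono hg2.ne (eLpNorm_mono_ae h)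

/-- A sublinear construction `f ↦ T|f|` with values in the `[0,∞]`-valued functions of `x`, as
shared by the Cesàro operator, the Copson operator and the nonincreasing majorant. -/
structure SublinearOperator (I : BaseInterval) where
  /-- the function `T|f|` -/
  toFun : I.L0 → ℝ → ℝ≥0∞
  measurable_toFun : ∀ f, Measurable (toFun f)
  add_le : ∀ f g x, toFun (f + g) x ≤ toFun f x + toFun g x
  smul_eq : ∀ (c : ℝ) f x, toFun (c • f) x = ‖c‖ₑ * toFun f x
  eq_zero : ∀ f, (∀ᵐ x ∂I.measure, toFun f x = 0) → f = 0

namespace SublinearOperator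

variable {I : BaseInterval} (T : SublinearOperator I) (X : BanachFunctionSpace I)

/-- The class in `L⁰(I)` of `T|f|` (meaningful when `T|f|` is finite a.e.). -/
def toL0 (f : I.L0) : I.L0 :=
  AEEqFun.mk (fun x => (T.toFun f x).toReal)
    (T.measurable_toFun f).ennreal_toReal.aestronglyMeasurable

theorem coe_toL0 (f : I.L0) : T.toL0 f =ᵐ[I.measure] fun x => (T.toFun f x).toReal :=
  AEEqFun.coeFn_mk _ _

theorem toFun_zero (x : ℝ) : T.toFun 0 x = 0 := by
  have h := T.smul_eq 0 0 x
  simpa using h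

theorem toL0_smul (c : ℝ) (f : I.L0) : T.toL0 (c • f) = |c| • T.toL0 f := by
  apply AEEqFun.ext
  filter_upwards [T.coe_toL0 (c • f), T.coe_toL0 f, AEEqFun.coeFn_smul |c| (T.toL0 f)]
    with x h1 h2 h3
  rw [h1, h3, Pi.smul_apply, h2, T.smul_eq]
  simp

theorem toL0_add_le {f g : I.L0} (hf : ∀ᵐ x ∂I.measure, T.toFun f x ≠ ∞)
    (hg : ∀ᵐ x ∂I.measure, T.toFun g x ≠ ∞) :
    ∀ᵐ x ∂I.measure, |T.toL0 (f + g) x| ≤ |(T.toL0 f + T.toL0 g) x| := by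
  filter_upwards [hf, hg, T.coe_toL0 (f + g), T.coe_toL0 f, T.coe_toL0 g,
    AEEqFun.coeFn_add (T.toL0 f) (T.toL0 g)] with x h1 h2 h3 h4 h5 h6
  rw [h3, h6, Pi.add_apply, h4, h5, abs_of_nonneg ENNReal.toReal_nonneg,
    abs_of_nonneg (add_nonneg ENNReal.toReal_nonneg ENNReal.toReal_nonneg),
    ← ENNReal.toReal_add h1 h2]
  exact ENNReal.toReal_mono (ENNReal.add_ne_top.mpr ⟨h1, h2⟩) (T.add_le f g x)

/-- The linear space `{f ∈ L⁰(I) : T|f| ∈ X}`; in particular `T|f|` has to be finite a.e. -/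
def domainSubmodule : Submodule ℝ I.L0 where
  carrier := {f | (∀ᵐ x ∂I.measure, T.toFun f x ≠ ∞) ∧ T.toL0 f ∈ X.toSubmodule}
  zero_mem' := by
    refine ⟨ae_of_all _ fun x => by simp [T.toFun_zero], ?_⟩
    have h := T.toL0_smul 0 0
    rw [abs_zero, zero_smul, zero_smul] at h
    rw [h]
    exact X.toSubmodule.zero_mem
  add_mem' := by
    rintro f g ⟨hf, hfX⟩ ⟨hg, hgX⟩
    refine ⟨?_, X.ideal_mem _ _ (T.toL0_add_le hf hg) (X.toSubmodule.add_mem hfX hgX)⟩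
    filter_upwards [hf, hg] with x h1 h2
    exact ne_top_of_le_ne_top (ENNReal.add_ne_top.mpr ⟨h1, h2⟩) (T.add_le f g x)
  smul_mem' := by
    rintro c f ⟨hf, hfX⟩
    refine ⟨?_, ?_⟩
    · filter_upwards [hf] with x h1
      rw [T.smul_eq]
      exact ENNReal.mul_ne_top enorm_ne_top h1
    · change T.toL0 (c • f) ∈ X.toSubmodule
      rw [T.toL0_smul]
      exact X.toSubmodule.smul_mem _ hfX

/-- The space `TX = {f ∈ L⁰(I) : T|f| ∈ X}`, to be normed by `‖f‖ = ‖T|f|‖_X`. -/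
def Domain : Type := T.domainSubmodule X

instance : AddCommGroup (T.Domain X) := inferInstanceAs (AddCommGroup (T.domainSubmodule X))

instance : Module ℝ (T.Domain X) := inferInstanceAs (Module ℝ (T.domainSubmodule X))

instance : Norm (T.Domain X) where
  norm f := X.norm ⟨T.toL0 f.1, f.2.2⟩

variable {T X} in
theorem norm_def (f : T.Domain X) : ‖f‖ = X.norm ⟨T.toL0 f.1, f.2.2⟩ := rfl

theorem domain_core : NormedSpace.Core ℝ (T.Domain X) where
  norm_nonneg f := X.norm_nonneg _
  norm_smul c f := by
    rw [norm_def, norm_def]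
    have h : (⟨T.toL0 (c • f).1, (c • f).2.2⟩ : X.toSubmodule) = |c| • ⟨T.toL0 f.1, f.2.2⟩ :=
      Subtype.ext (T.toL0_smul c f.1)
    rw [h, X.norm_smul, abs_abs, Real.norm_eq_abs]
  norm_triangle f g := by
    rw [norm_def, norm_def, norm_def]
    exact (X.ideal_norm_le _ _ (T.toL0_add_le f.2.1 g.2.1)).trans (X.norm_add_le _ _)
  norm_eq_zero_iff f := by
    constructor
    · intro h
      have h0 : T.toL0 f.1 = 0 := congrArg Subtype.val (X.norm_eq_zero _ h)
      refine Subtype.ext (T.eq_zero f.1 ?_)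
      filter_upwards [T.coe_toL0 f.1, f.2.1,
        (show T.toL0 f.1 =ᵐ[I.measure] (0 : ℝ → ℝ) from h0 ▸ AEEqFun.coeFn_zero)] with x h1 h2 h3
      rw [h1] at h3
      exact ((ENNReal.toReal_eq_zero_iff _).mp h3).resolve_right h2
    · rintro rfl
      have h : (⟨T.toL0 (0 : T.Domain X).1, (0 : T.Domain X).2.2⟩ : X.toSubmodule)
          = (0 : ℝ) • ⟨T.toL0 (0 : T.Domain X).1, (0 : T.Domain X).2.2⟩ := by
        refine Subtype.ext ?_
        have h := T.toL0_smul 0 0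
        rw [abs_zero, zero_smul] at h
        exact h
      rw [norm_def, h, X.norm_smul, abs_zero, zero_mul]

instance : NormedAddCommGroup (T.Domain X) := NormedAddCommGroup.ofCore (T.domain_core X)

instance : NormedSpace ℝ (T.Domain X) := NormedSpace.ofCore (T.domain_core X)

end SublinearOperator

section Operators

variable {I : BaseInterval}

theorem coe_add_restrict (f g : I.L0) {s : Set ℝ} (hs : s ⊆ I.toSet) :
    (f + g : I.L0) =ᵐ[volume.restrict s] fun t => f t + g t :=
  coe_ae_congr_of_le (AEEqFun.coeFn_add f g) hs

theorem coe_smul_restrict (c : ℝ) (f : I.L0) {s : Set ℝ} (hs : s ⊆ I.toSet) :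
    (c • f : I.L0) =ᵐ[volume.restrict s] fun t => c * f t :=
  coe_ae_congr_of_le (AEEqFun.coeFn_smul c f) hs

theorem aemeasurable_div_restrict (f : I.L0) {s : Set ℝ} (hs : s ⊆ I.toSet) :
    AEMeasurable (fun t => ‖f t‖ₑ / ENNReal.ofReal t) (volume.restrict s) :=
  (f.aestronglyMeasurable.aemeasurable.mono_measure
    (Measure.restrict_mono_set volume hs)).enorm.div ENNReal.measurable_ofReal.aemeasurable

theorem aemeasurable_restrict (f : I.L0) {s : Set ℝ} (hs : s ⊆ I.toSet) :
    AEMeasurable f (volume.restrict s) :=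
  f.aestronglyMeasurable.aemeasurable.mono_measure (Measure.restrict_mono_set volume hs)

/-- `C|f|(x) = (1/x) ∫_0^x |f(t)| dt`. -/
def cesaroFun (f : I.L0) (x : ℝ) : ℝ≥0∞ :=
  (ENNReal.ofReal x)⁻¹ * ∫⁻ t in I.toSet ∩ Icc 0 x, ‖f t‖ₑ

/-- `C^*|f|(x) = ∫_{I ∩ [x,∞)} |f(t)|/t dt`. -/
def copsonFun (f : I.L0) (x : ℝ) : ℝ≥0∞ :=
  ∫⁻ t in I.toSet ∩ Ici x, ‖f t‖ₑ / ENNReal.ofReal t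

/-- The nonincreasing majorant of `f`, the essential supremum of `|f(t)|` over `t ∈ I`,
`t ≥ x`. -/
def tandoriFun (f : I.L0) (x : ℝ) : ℝ≥0∞ :=
  essSup (fun t => ‖f t‖ₑ) (volume.restrict (I.toSet ∩ Ici x))

theorem BaseInterval.exists_pos_lt (I : BaseInterval) {a : ℝ} (ha : 0 < a) {P : ℝ → Prop}
    (h : ∀ᵐ x ∂I.measure, P x) : ∃ x, 0 < x ∧ x < a ∧ P x := by
  have hs : Ioo 0 (min a 1) ⊆ I.toSet := by
    intro x hx
    cases I
    · exact ⟨hx.1.le, (hx.2.trans_le (min_le_right _ _)).le⟩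
    · exact hx.1.le
  have h2 : ∀ᵐ x ∂volume.restrict (Ioo 0 (min a 1)), P x :=
    ae_mono (Measure.restrict_mono_set volume hs) h
  have h3 : (volume.restrict (Ioo (0 : ℝ) (min a 1))) ≠ 0 := by
    rw [Ne, Measure.restrict_eq_zero, Real.volume_Ioo]
    simp [ha]
  have : (ae (volume.restrict (Ioo (0 : ℝ) (min a 1)))).NeBot := ae_neBot.mpr h3
  obtain ⟨x, hx, hP⟩ := ((ae_restrict_mem measurableSet_Ioo).and h2).exists
  exact ⟨x, hx.1, hx.2.trans_le (min_le_left _ _), hP⟩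

/-- Vanishing a.e. on `I ∩ [x,∞)` for a.e. `x ∈ I` implies vanishing. -/
theorem BaseInterval.eq_zero_of_tails (f : I.L0)
    (h : ∀ᵐ x ∂I.measure, ∀ᵐ t ∂volume.restrict (I.toSet ∩ Ici x), f t = 0) : f = 0 := by
  have h1 : ∀ n : ℕ, ∀ᵐ t ∂volume.restrict (I.toSet ∩ Ici (1 / ((n : ℝ) + 1))), f t = 0 := by
    intro n
    obtain ⟨x, -, hx, hP⟩ := I.exists_pos_lt (a := 1 / ((n : ℝ) + 1)) (by positivity) h
    exact ae_mono (Measure.restrict_mono_set volume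
      (inter_subset_inter_right _ (Ici_subset_Ici.mpr hx.le))) hP
  have h2 : ∀ᵐ t ∂volume.restrict (⋃ n : ℕ, I.toSet ∩ Ici (1 / ((n : ℝ) + 1))), f t = 0 :=
    (ae_restrict_iUnion_iff _ _).mpr h1
  have h3 : I.measure ≤ volume.restrict (⋃ n : ℕ, I.toSet ∩ Ici (1 / ((n : ℝ) + 1))) := by
    refine Measure.restrict_mono' ?_ le_rfl
    have h0 : ∀ᵐ t : ℝ, t ≠ 0 := Measure.ae_ne volume 0
    filter_upwards [h0] with t ht htI
    have htn : 0 ≤ t := by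
      cases I
      · exact htI.1
      · exact htI
    obtain ⟨n, hn⟩ := exists_nat_one_div_lt (lt_of_le_of_ne htn (Ne.symm ht))
    exact mem_iUnion.mpr ⟨n, htI, hn.le⟩
  apply AEEqFun.ext
  filter_upwards [ae_mono h3 h2, (AEEqFun.coeFn_zero : ((0 : I.L0) : ℝ → ℝ) =ᵐ[I.measure] 0)]
    with t h4 h5
  rw [h4, h5]
  rfl

theorem BaseInterval.measurableSet_toSet (I : BaseInterval) : MeasurableSet I.toSet := by
  cases I
  · exact measurableSet_Icc
  · exact measurableSet_Ici

/-- Vanishing a.e. on `I ∩ [0,x]` for a.e. `x ∈ I` implies vanishing. -/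
theorem BaseInterval.eq_zero_of_heads (f : I.L0)
    (h : ∀ᵐ x ∂I.measure, ∀ᵐ t ∂volume.restrict (I.toSet ∩ Icc 0 x), f t = 0) : f = 0 := by
  obtain ⟨b, hb, hcov⟩ : ∃ b : ℕ → ℝ, (∀ n, ∃ c, b n < c ∧ Ioo (b n) c ⊆ I.toSet) ∧
      ∀ᵐ t : ℝ, t ∈ I.toSet → ∃ n, t ≤ b n := by
    cases I
    · refine ⟨fun n => 1 - 1 / ((n : ℝ) + 1), fun n => ⟨1, ?_, fun x hx => ⟨?_, hx.2.le⟩⟩, ?_⟩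
      · have : 0 < 1 / ((n : ℝ) + 1) := by positivity
        linarith
      · have h1 : 1 / ((n : ℝ) + 1) ≤ 1 := by
          rw [div_le_one (by positivity)]
          linarith [Nat.cast_nonneg (α := ℝ) n]
        have h2 : 1 - 1 / ((n : ℝ) + 1) < x := hx.1
        linarith
      · have h0 : ∀ᵐ t : ℝ, t ≠ 1 := Measure.ae_ne volume 1
        filter_upwards [h0] with t ht htI
        obtain ⟨n, hn⟩ := exists_nat_one_div_lt (sub_pos.mpr (lt_of_le_of_ne htI.2 ht))
        exact ⟨n, by linarith⟩
    · refine ⟨fun n => n, fun n => ⟨n + 1, by simp, fun x hx => ?_⟩, ?_⟩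
      · exact (Nat.cast_nonneg n).trans hx.1.le
      · exact ae_of_all _ fun t _ => exists_nat_ge t
  have h1 : ∀ n : ℕ, ∀ᵐ t ∂volume.restrict (I.toSet ∩ Icc 0 (b n)), f t = 0 := by
    intro n
    obtain ⟨c, hc, hs⟩ := hb n
    have h3 : (volume.restrict (Ioo (b n) c)) ≠ 0 := by
      rw [Ne, Measure.restrict_eq_zero, Real.volume_Ioo]
      simp [hc]
    have : (ae (volume.restrict (Ioo (b n) c))).NeBot := ae_neBot.mpr h3
    obtain ⟨x, hx, hP⟩ := ((ae_restrict_mem measurableSet_Ioo).and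
      (ae_mono (Measure.restrict_mono_set volume hs) h)).exists
    exact ae_mono (Measure.restrict_mono_set volume
      (inter_subset_inter_right _ (Icc_subset_Icc_right hx.1.le))) hP
  have h2 : ∀ᵐ t ∂volume.restrict (⋃ n : ℕ, I.toSet ∩ Icc 0 (b n)), f t = 0 :=
    (ae_restrict_iUnion_iff _ _).mpr h1
  have h3 : I.measure ≤ volume.restrict (⋃ n : ℕ, I.toSet ∩ Icc 0 (b n)) := by
    refine Measure.restrict_mono' ?_ le_rfl
    filter_upwards [hcov] with t ht htI
    have htn : 0 ≤ t := by
      cases I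
      · exact htI.1
      · exact htI
    obtain ⟨n, hn⟩ := ht htI
    exact mem_iUnion.mpr ⟨n, htI, htn, hn⟩
  apply AEEqFun.ext
  filter_upwards [ae_mono h3 h2, (AEEqFun.coeFn_zero : ((0 : I.L0) : ℝ → ℝ) =ᵐ[I.measure] 0)]
    with t h4 h5
  rw [h4, h5]
  rfl

variable (I)

/-- The Cesàro operator. -/
def cesaro : SublinearOperator I where
  toFun := cesaroFun
  measurable_toFun f := by
    have hm : Monotone fun x => ∫⁻ t in I.toSet ∩ Icc 0 x, ‖f t‖ₑ := fun x y hxy =>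
      lintegral_mono_set (inter_subset_inter_right _ (Icc_subset_Icc_right hxy))
    exact ENNReal.measurable_ofReal.inv.mul hm.measurable
  add_le f g x := by
    unfold cesaroFun
    rw [← mul_add, ← lintegral_add_left' (aemeasurable_restrict f inter_subset_left).enorm]
    refine mul_le_mul_right (lintegral_mono_ae ?_) _
    filter_upwards [coe_add_restrict f g (inter_subset_left (s := I.toSet) (t := Icc 0 x))]
      with t ht
    rw [ht]
    exact enorm_add_le _ _
  smul_eq c f x := by
    unfold cesaroFun
    rw [mul_left_comm, ← lintegral_const_mul' _ _ enorm_ne_top]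
    congr 1
    apply lintegral_congr_ae
    filter_upwards [coe_smul_restrict c f (inter_subset_left (s := I.toSet) (t := Icc 0 x))]
      with t ht
    rw [ht, enorm_mul]
  eq_zero f h := by
    apply BaseInterval.eq_zero_of_heads
    filter_upwards [h] with x hx
    have h1 := (mul_eq_zero.mp hx).resolve_left (ENNReal.inv_ne_zero.mpr ENNReal.ofReal_ne_top)
    rw [lintegral_eq_zero_iff' (aemeasurable_restrict f inter_subset_left).enorm] at h1
    filter_upwards [h1] with t ht
    exact enorm_eq_zero.mp ht

/-- The Copson operator. -/
def copson : SublinearOperator I where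
  toFun := copsonFun
  measurable_toFun f := by
    have hm : Antitone fun x => copsonFun f x := fun x y hxy =>
      lintegral_mono_set (inter_subset_inter_right _ (Ici_subset_Ici.mpr hxy))
    exact hm.measurable
  add_le f g x := by
    unfold copsonFun
    rw [← lintegral_add_left' (aemeasurable_div_restrict f inter_subset_left)]
    apply lintegral_mono_ae
    filter_upwards [coe_add_restrict f g (inter_subset_left (s := I.toSet) (t := Ici x))]
      with t ht
    rw [ht, ← ENNReal.add_div]
    exact ENNReal.div_le_div_right (enorm_add_le _ _) _
  smul_eq c f x := by
    unfold copsonFun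
    rw [← lintegral_const_mul' _ _ enorm_ne_top]
    apply lintegral_congr_ae
    filter_upwards [coe_smul_restrict c f (inter_subset_left (s := I.toSet) (t := Ici x))]
      with t ht
    rw [ht, enorm_mul, mul_div_assoc]
  eq_zero f h := by
    apply BaseInterval.eq_zero_of_tails
    filter_upwards [h] with x hx
    unfold copsonFun at hx
    rw [lintegral_eq_zero_iff' (aemeasurable_div_restrict f inter_subset_left)] at hx
    filter_upwards [hx] with t ht
    have h1 : ‖f t‖ₑ / ENNReal.ofReal t = 0 := ht
    exact enorm_eq_zero.mp ((ENNReal.div_eq_zero_iff.mp h1).resolve_right ENNReal.ofReal_ne_top)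

/-- The nonincreasing majorant. -/
def tandori : SublinearOperator I where
  toFun := tandoriFun
  measurable_toFun f := by
    have hm : Antitone fun x => tandoriFun f x := fun x y hxy =>
      essSup_mono_measure' (Measure.restrict_mono_set volume
        (inter_subset_inter_right _ (Ici_subset_Ici.mpr hxy)))
    exact hm.measurable
  add_le f g x := by
    unfold tandoriFun
    refine le_trans (essSup_mono_ae ?_) (ENNReal.essSup_add_le _ _)
    filter_upwards [coe_add_restrict f g (inter_subset_left (s := I.toSet) (t := Ici x))]
      with t ht
    rw [ht]
    exact enorm_add_le _ _
  smul_eq c f x := by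
    unfold tandoriFun
    rw [← ENNReal.essSup_const_mul]
    apply essSup_congr_ae
    filter_upwards [coe_smul_restrict c f (inter_subset_left (s := I.toSet) (t := Ici x))]
      with t ht
    rw [ht, enorm_mul]
  eq_zero f h := by
    apply BaseInterval.eq_zero_of_tails
    filter_upwards [h] with x hx
    filter_upwards [ENNReal.essSup_eq_zero_iff.mp hx] with t ht
    exact enorm_eq_zero.mp ht

end Operators

/-- The abstract Cesàro function space `CX`. -/
abbrev CesaroSpace {I : BaseInterval} (X : BanachFunctionSpace I) : Type := (cesaro I).Domain X

/-- The abstract Copson function space `C^*X`. -/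
abbrev CopsonSpace {I : BaseInterval} (X : BanachFunctionSpace I) : Type := (copson I).Domain X

/-- The abstract Tandori function space of `X`. -/
abbrev TandoriSpace {I : BaseInterval} (X : BanachFunctionSpace I) : Type :=
  (tandori I).Domain X

/-- `Ces_p = C L^p`. -/
abbrev Ces (I : BaseInterval) (p : ℝ≥0∞) [Fact (1 ≤ p)] : Type :=
  CesaroSpace (lebesgueSpace I p)

/-- `Cop_p = C^* L^p`. -/
abbrev Cop (I : BaseInterval) (p : ℝ≥0∞) [Fact (1 ≤ p)] : Type :=
  CopsonSpace (lebesgueSpace I p)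

/-- The weak fixed point property: every nonexpansive self-map of a nonempty, weakly compact,
convex subset has a fixed point. -/
def WeakFixedPointProperty (E : Type*) [NormedAddCommGroup E] [NormedSpace ℝ E] : Prop :=
  ∀ K : Set E, K.Nonempty → IsCompact (toWeakSpace ℝ E '' K) → Convex ℝ K →
    ∀ T : K → K, (∀ x y : K, ‖(T x : E) - (T y : E)‖ ≤ ‖(x : E) - (y : E)‖) →
      ∃ x₀ : K, T x₀ = x₀

end

/-! Failure of the weak fixed point property passes from a normed space to every space containing a
linear copy of it on which the norm is multiplied by a positive constant. It therefore suffices to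
find one bad space and embed it.

The bad space is `L¹` of the circle, by Alspach's example. On the weakly compact convex set of `f`
with `0 ≤ f ≤ 1` and `∫ f = 1/2`, the map equal to `min (2 f(2t)) 1` on one half of the circle and
to `max (2 f(2t) - 1) 0` on the other is an isometry. At a fixed point, comparing `∫ f(1 - f)` with
its value after one step forces `f ∈ {0,1}` a.e.; then `f` is invariant under doubling, hence
constant by ergodicity, and its integral is `0` or `1`, not `1/2`. Since bounded sequences contain
every separable space isometrically, `ℓ^∞` is bad too.

`L¹` embeds in three of the families: by Tonelli the norms of `Ces_1[0,1]`, `Cop_1` and `Cop_∞` are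
the weighted `L¹` norms with weights `log (1/t)`, `1` and `1/t`. `ℓ^∞` embeds in the other two by
functions constant on blocks, each term of the sequence being used on infinitely many blocks. For
`Ces_∞` the blocks shrink to `0` so fast that suitable averages nearly see a single block; for the
Tandori space they accumulate at a point `a`, so that the majorant is `‖x‖` times the indicator of
`[0,a)`. -/

noncomputable section

open BaseInterval
open scoped BoundedContinuousFunction

/-! ### Weak compactness, embeddings and bounded sequences -/

/-- In a Hilbert space, bounded closed convex sets are weakly compact. -/
theorem isCompact_toWeakSpace_image {H : Type*} [NormedAddCommGroup H] [InnerProductSpace ℝ H]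
    [CompleteSpace H] {K : Set H} (hb : Bornology.IsBounded K) (hc : IsClosed K)
    (hK : Convex ℝ K) : IsCompact (toWeakSpace ℝ H '' K) := by
  obtain ⟨r, hr⟩ := hb.subset_closedBall 0
  -- The Riesz isomorphism is continuous from the weak-* to the weak topology, so Banach–Alaoglu
  -- makes balls of `H` weakly compact.
  let Ψ : WeakDual ℝ H → WeakSpace ℝ H := fun φ =>
    toWeakSpace ℝ H ((InnerProductSpace.toDual ℝ H).symm (WeakDual.toStrongDual φ))
  have hΨ : Continuous Ψ := by
    refine WeakBilin.continuous_of_continuous_eval _ fun ψ => ?_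
    have h : ∀ φ : WeakDual ℝ H, ψ ((InnerProductSpace.toDual ℝ H).symm
        (WeakDual.toStrongDual φ)) = φ ((InnerProductSpace.toDual ℝ H).symm ψ) := by
      intro φ
      rw [← InnerProductSpace.toDual_symm_apply (𝕜 := ℝ) (y := ψ), real_inner_comm,
        InnerProductSpace.toDual_symm_apply]
      rfl
    exact (WeakDual.eval_continuous ((InnerProductSpace.toDual ℝ H).symm ψ)).congr
      fun φ => (h φ).symm
  have hball := (WeakDual.isCompact_closedBall (𝕜 := ℝ) (0 : StrongDual ℝ H) r).image hΨ
  -- For convex sets the norm closure and the weak closure coincide.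
  have hcl : IsClosed (toWeakSpace ℝ H '' K) := by
    have h := hK.toWeakSpace_closure ℝ
    rw [hc.closure_eq] at h
    rw [h]
    exact isClosed_closure
  refine hball.of_isClosed_subset hcl ?_
  rintro _ ⟨x, hx, rfl⟩
  refine ⟨StrongDual.toWeakDual (InnerProductSpace.toDual ℝ H x), ?_, ?_⟩
  · change InnerProductSpace.toDual ℝ H x ∈ Metric.closedBall 0 r
    rw [mem_closedBall_zero_iff, LinearIsometryEquiv.norm_map]
    exact mem_closedBall_zero_iff.mp (hr hx)
  · change toWeakSpace ℝ H ((InnerProductSpace.toDual ℝ H).symm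
      (InnerProductSpace.toDual ℝ H x)) = _
    rw [LinearIsometryEquiv.symm_apply_apply]

theorem IsCompact.toWeakSpace_image {E F : Type*} [NormedAddCommGroup E] [NormedSpace ℝ E]
    [NormedAddCommGroup F] [NormedSpace ℝ F] {K : Set E}
    (hK : IsCompact (toWeakSpace ℝ E '' K)) (Φ : E →L[ℝ] F) :
    IsCompact (toWeakSpace ℝ F '' (Φ '' K)) := by
  have h := hK.image (WeakSpace.map Φ).continuous
  rw [image_image] at h ⊢
  exact h

/-- The failure of the weak fixed point property passes to spaces containing a scaled isometric
copy. -/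
theorem not_weakFixedPointProperty_of_embedding {E F : Type*} [NormedAddCommGroup E]
    [NormedSpace ℝ E] [NormedAddCommGroup F] [NormedSpace ℝ F] (Φ : E →ₗ[ℝ] F) {c : ℝ}
    (hc : 0 < c) (hΦ : ∀ x, ‖Φ x‖ = c * ‖x‖) (hE : ¬ WeakFixedPointProperty E) :
    ¬ WeakFixedPointProperty F := by
  intro hF
  apply hE
  intro K hne hcomp hconv T hT
  have hinj : Function.Injective Φ := by
    rw [injective_iff_map_eq_zero]
    intro x hx
    have h := hΦ x
    rw [hx, norm_zero] at h
    exact norm_eq_zero.mp ((mul_eq_zero.mp h.symm).resolve_left hc.ne')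
  let e : K ≃ Φ '' K := Equiv.Set.image Φ K hinj
  have he : ∀ y, Φ (e.symm y) = y := fun y =>
    congrArg Subtype.val (e.apply_symm_apply y)
  obtain ⟨y, hy⟩ := hF (Φ '' K) (hne.image _)
    (hcomp.toWeakSpace_image (Φ.mkContinuous c fun x => (hΦ x).le)) (hconv.linear_image Φ)
    (fun y => e (T (e.symm y))) (by
      intro x y
      change ‖Φ (T (e.symm x)) - Φ (T (e.symm y))‖ ≤ _
      rw [← he x, ← he y, ← map_sub, ← map_sub, hΦ, hΦ]
      exact mul_le_mul_of_nonneg_left (hT _ _) hc.le)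
  exact ⟨e.symm y, by rw [Equiv.eq_symm_apply]; exact hy⟩

/-- A separable normed space embeds isometrically into the bounded sequences. -/
theorem exists_isometric_embedding_bounded_sequences (E : Type*) [NormedAddCommGroup E]
    [NormedSpace ℝ E] [TopologicalSpace.SeparableSpace E] :
    ∃ Φ : E →ₗ[ℝ] (ℕ →ᵇ ℝ), ∀ x, ‖Φ x‖ = ‖x‖ := by
  -- Norming functionals of a dense sequence serve as the coordinates of the embedding.
  have hex : ∀ n : ℕ, ∃ g : StrongDual ℝ E, ‖g‖ ≤ 1 ∧
      g (TopologicalSpace.denseSeq E n) = ‖TopologicalSpace.denseSeq E n‖ :=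
    fun n => exists_dual_vector'' ℝ _
  choose g hg1 hg2 using hex
  have hle : ∀ n x, ‖g n x‖ ≤ ‖x‖ := fun n x =>
    ((g n).le_opNorm x).trans (mul_le_of_le_one_left (norm_nonneg x) (hg1 n))
  refine ⟨{ toFun := fun x => BoundedContinuousFunction.ofNormedAddCommGroup
              (fun n => g n x) continuous_of_discreteTopology ‖x‖ fun n => hle n x
            map_add' := fun x y => by ext n; simp
            map_smul' := fun c x => by ext n; simp }, fun x => le_antisymm ?_ ?_⟩
  · exact BoundedContinuousFunction.norm_ofNormedAddCommGroup_le _ (norm_nonneg x)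
      fun n => hle n x
  · refine le_of_forall_pos_le_add fun ε hε => ?_
    obtain ⟨n, hn⟩ := (TopologicalSpace.denseRange_denseSeq E).exists_dist_lt x (half_pos hε)
    set y := TopologicalSpace.denseSeq E n with hy
    rw [dist_eq_norm] at hn
    have h1 := BoundedContinuousFunction.norm_coe_le_norm
      (BoundedContinuousFunction.ofNormedAddCommGroup
              (fun n => g n x) continuous_of_discreteTopology ‖x‖ fun n => hle n x) n
    have h2 : ‖g n x‖ ≤ ‖BoundedContinuousFunction.ofNormedAddCommGroup
              (fun n => g n x) continuous_of_discreteTopology ‖x‖ fun n => hle n x‖ := h1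
    -- Replacing `x` by `y` costs `‖x - y‖` once here and once in `h6`, which is why `y` was taken
    -- within `ε / 2`.
    have h3 : ‖y‖ ≤ ‖g n x‖ + ‖x - y‖ := by
      have h4 : ‖y‖ = g n x - g n (x - y) := by rw [map_sub, hg2 n]; ring
      have h5 := hle n (x - y)
      rw [Real.norm_eq_abs] at h5 ⊢
      have := neg_abs_le (g n (x - y))
      have := le_abs_self (g n x)
      linarith
    have h6 : ‖x‖ ≤ ‖y‖ + ‖x - y‖ := by
      have := norm_add_le y (x - y)
      rwa [add_sub_cancel] at this
    change ‖x‖ ≤ ‖BoundedContinuousFunction.ofNormedAddCommGroup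
              (fun n => g n x) continuous_of_discreteTopology ‖x‖ fun n => hle n x‖ + ε
    linarith

theorem not_weakFixedPointProperty_bounded_sequences {E : Type*} [NormedAddCommGroup E]
    [NormedSpace ℝ E] [TopologicalSpace.SeparableSpace E] (hE : ¬ WeakFixedPointProperty E) :
    ¬ WeakFixedPointProperty (ℕ →ᵇ ℝ) := by
  obtain ⟨Φ, hΦ⟩ := exists_isometric_embedding_bounded_sequences E
  exact not_weakFixedPointProperty_of_embedding Φ one_pos (fun x => by rw [hΦ, one_mul]) hE

/-! ### A weakly compact convex set in `L¹` -/

section WeakCompactness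

variable {Ω : Type*} [MeasurableSpace Ω] (μ : Measure Ω)

/-- The elements of `L¹` with values in `[0,1]` and a prescribed integral. -/
def unitIntervalFunctions (m : ℝ) : Set (Lp ℝ 1 μ) :=
  {f | (∀ᵐ t ∂μ, f t ∈ Icc (0 : ℝ) 1) ∧ ∫ t, f t ∂μ = m}

variable {μ}

theorem convex_ae_mem_Icc_integral_eq {p : ℝ≥0∞} (hp : 1 ≤ p) [IsFiniteMeasure μ] (m : ℝ) :
    Convex ℝ {f : Lp ℝ p μ | (∀ᵐ t ∂μ, f t ∈ Icc (0 : ℝ) 1) ∧ ∫ t, f t ∂μ = m} := by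
  rintro f ⟨hf, hfm⟩ g ⟨hg, hgm⟩ a b ha hb hab
  have hc : (a • f + b • g : Lp ℝ p μ) =ᵐ[μ] fun t => a * f t + b * g t := by
    filter_upwards [Lp.coeFn_add (a • f) (b • g), Lp.coeFn_smul a f, Lp.coeFn_smul b g]
      with t h1 h2 h3
    rw [h1, Pi.add_apply, h2, h3]
    rfl
  refine ⟨?_, ?_⟩
  · filter_upwards [hc, hf, hg] with t h1 h2 h3
    rw [h1]
    exact convex_Icc (0 : ℝ) 1 h2 h3 ha hb hab
  · rw [integral_congr_ae hc, integral_add, integral_const_mul, integral_const_mul, hfm, hgm,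
      ← add_mul, hab, one_mul]
    · exact ((Lp.memLp f).integrable hp).const_mul a
    · exact ((Lp.memLp g).integrable hp).const_mul b

variable (μ) in
/-- The inclusion of `L²` into `L¹` over a probability space. -/
def inclusionL2L1 [IsProbabilityMeasure μ] : Lp ℝ 2 μ →L[ℝ] Lp ℝ 1 μ :=
  LinearMap.mkContinuous
    { toFun := fun f => ((Lp.memLp f).mono_exponent (p := 1) one_le_two).toLp f
      map_add' := fun f g => by
        rw [← MemLp.toLp_add]
        exact MemLp.toLp_congr _ _ (Lp.coeFn_add f g)
      map_smul' := fun c f => by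
        rw [RingHom.id_apply, ← MemLp.toLp_const_smul]
        exact MemLp.toLp_congr _ _ (Lp.coeFn_smul c f) } 1 (by
    intro f
    rw [one_mul]
    change ‖((Lp.memLp f).mono_exponent (p := 1) one_le_two).toLp f‖ ≤ ‖f‖
    rw [Lp.norm_toLp, Lp.norm_def]
    exact ENNReal.toReal_mono (Lp.eLpNorm_ne_top f)
      (eLpNorm_le_eLpNorm_of_exponent_le one_le_two (Lp.aestronglyMeasurable f)))

theorem coeFn_inclusionL2L1 [IsProbabilityMeasure μ] (f : Lp ℝ 2 μ) :
    inclusionL2L1 μ f =ᵐ[μ] f :=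
  MemLp.coeFn_toLp ((Lp.memLp f).mono_exponent (p := 1) one_le_two)

/-- Functions with values in `[0,1]` lie in `L²`, where these constraints define a bounded closed
convex set. That set is weakly compact, and the continuous inclusion into `L¹` preserves this. -/
theorem isCompact_unitIntervalFunctions [IsProbabilityMeasure μ] (m : ℝ) :
    IsCompact (toWeakSpace ℝ (Lp ℝ 1 μ) '' unitIntervalFunctions μ m) := by
  let K : Set (Lp ℝ 2 μ) := {f | (∀ᵐ t ∂μ, f t ∈ Icc (0 : ℝ) 1) ∧ ∫ t, f t ∂μ = m}
  have himage : inclusionL2L1 μ '' K = unitIntervalFunctions μ m := by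
    apply Subset.antisymm
    · rintro _ ⟨f, ⟨hf, hfm⟩, rfl⟩
      refine ⟨?_, (integral_congr_ae (coeFn_inclusionL2L1 f)).trans hfm⟩
      filter_upwards [hf, coeFn_inclusionL2L1 f] with t h1 h2
      rwa [h2]
    · rintro f ⟨hf, hfm⟩
      have hmem : MemLp f 2 μ := by
        refine MemLp.of_bound (Lp.aestronglyMeasurable f) 1 ?_
        filter_upwards [hf] with t ht
        rw [Real.norm_eq_abs, abs_of_nonneg ht.1]
        exact ht.2
      have hco := hmem.coeFn_toLp
      refine ⟨hmem.toLp f, ⟨?_, (integral_congr_ae hco).trans hfm⟩, ?_⟩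
      · filter_upwards [hf, hco] with t h1 h2
        rwa [h2]
      · exact Lp.ext ((coeFn_inclusionL2L1 _).trans hco)
  rw [← himage]
  -- Written as an order interval, the pointwise constraint is visibly closed, and bounded by the
  -- norm of the constant `1`.
  have hIcc : {f : Lp ℝ 2 μ | ∀ᵐ t ∂μ, f t ∈ Icc (0 : ℝ) 1} = Icc 0 (Lp.const 2 μ 1) := by
    ext f
    rw [mem_ofPred_eq, mem_Icc, ← Lp.coeFn_le, ← Lp.coeFn_le]
    have h0 := Lp.coeFn_zero ℝ 2 μ
    have h1 := Lp.coeFn_const 2 μ (1 : ℝ)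
    constructor
    · intro h
      refine ⟨?_, ?_⟩
      · filter_upwards [h, h0] with t h2 h3
        rw [h3]
        exact h2.1
      · filter_upwards [h, h1] with t h2 h3
        rw [h3]
        exact h2.2
    · rintro ⟨h2, h3⟩
      filter_upwards [h0, h1, h2, h3] with t h4 h5 h6 h7
      rw [h4] at h6
      rw [h5] at h7
      exact ⟨h6, h7⟩
  have hKeq : K = Icc 0 (Lp.const 2 μ 1) ∩
      (fun f => ∫ t, inclusionL2L1 μ f t ∂μ) ⁻¹' {m} := by
    rw [← hIcc]
    ext f
    rw [mem_inter_iff, mem_preimage, integral_congr_ae (coeFn_inclusionL2L1 f)]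
    rfl
  refine (isCompact_toWeakSpace_image ?_ ?_ (convex_ae_mem_Icc_integral_eq one_le_two m)).toWeakSpace_image _
  · rw [isBounded_iff_forall_norm_le]
    refine ⟨‖Lp.const 2 μ (1 : ℝ)‖, fun f hf => ?_⟩
    have hf2 : f ∈ K := hf
    rw [hKeq] at hf2
    refine norm_le_norm_of_abs_le_abs ?_
    rw [abs_of_nonneg hf2.1.1, abs_of_nonneg (hf2.1.1.trans hf2.1.2)]
    exact hf2.1.2
  · change IsClosed K
    rw [hKeq]
    exact isClosed_Icc.inter
      (isClosed_singleton.preimage (continuous_integral.comp (inclusionL2L1 μ).continuous))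

end WeakCompactness

/-! ### The doubling map on the circle -/

section Circle

instance : IsProbabilityMeasure (volume : Measure UnitAddCircle) :=
  ⟨UnitAddCircle.measure_univ⟩

/-- The image in the circle of `[0,1/2)`. -/
def halfCircle : Set UnitAddCircle :=
  {t | ((AddCircle.measurableEquivIco 1 0 t : Ico (0 : ℝ) (0 + 1)) : ℝ) < 1 / 2}

theorem measurableSet_halfCircle : MeasurableSet halfCircle :=
  (measurable_subtype_coe.comp (AddCircle.measurableEquivIco 1 0).measurable) measurableSet_Iio

theorem coe_mem_halfCircle {r : ℝ} : (r : UnitAddCircle) ∈ halfCircle ↔ Int.fract r < 1 / 2 := by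
  have h := AddCircle.coe_equivIco_mk_apply (1 : ℝ) r
  rw [div_one, mul_one] at h
  rw [← h]
  rfl

theorem add_half_mem_halfCircle (t : UnitAddCircle) :
    t + ((1 / 2 : ℝ) : UnitAddCircle) ∈ halfCircle ↔ t ∉ halfCircle := by
  induction t using QuotientAddGroup.induction_on with
  | H r =>
    change ((r + 1 / 2 : ℝ) : UnitAddCircle) ∈ halfCircle ↔ (r : UnitAddCircle) ∉ halfCircle
    rw [coe_mem_halfCircle, coe_mem_halfCircle, not_lt]
    have h0 := Int.fract_nonneg r
    have h1 := Int.fract_lt_one r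
    rcases lt_or_ge (Int.fract r) (1 / 2) with h | h
    · have h2 : Int.fract (r + 1 / 2) = Int.fract r + 1 / 2 := by
        rw [Int.fract_eq_iff]
        exact ⟨by linarith, by linarith, ⌊r⌋, by rw [← Int.self_sub_floor]; ring⟩
      rw [h2]
      constructor <;> intro <;> linarith
    · have h2 : Int.fract (r + 1 / 2) = Int.fract r - 1 / 2 := by
        rw [Int.fract_eq_iff]
        exact ⟨by linarith, by linarith, ⌊r⌋ + 1, by
          rw [← Int.self_sub_floor]; push_cast; ring⟩
      rw [h2]
      constructor <;> intro <;> linarith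

theorem two_nsmul_add_half (t : UnitAddCircle) :
    2 • (t + ((1 / 2 : ℝ) : UnitAddCircle)) = 2 • t := by
  rw [smul_add]
  have h : (2 : ℕ) • ((1 / 2 : ℝ) : UnitAddCircle) = ((1 : ℝ) : UnitAddCircle) := by
    rw [← AddCircle.coe_nsmul]
    norm_num
  rw [h, AddCircle.coe_period, add_zero]

theorem measurePreserving_two_nsmul :
    MeasurePreserving (fun t : UnitAddCircle => 2 • t) volume volume :=
  (AddCircle.ergodic_nsmul one_lt_two).toMeasurePreserving

/-- Rotation by `1/2` exchanges the two halves and does not change `2 • t`, so the two integrals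
agree; since doubling preserves measure, they add up to `∫ G`. -/
theorem setIntegral_halfCircle_comp {G : UnitAddCircle → ℝ} (hG : Integrable G) :
    ∫ t in halfCircle, G (2 • t) = (∫ t, G t) / 2 ∧
      ∫ t in halfCircleᶜ, G (2 • t) = (∫ t, G t) / 2 := by
  have hint : Integrable (fun t => G (2 • t)) :=
    (measurePreserving_two_nsmul.integrable_comp hG.aestronglyMeasurable).mpr hG
  have hsum := integral_add_compl measurableSet_halfCircle hint
  have htot : ∫ t, G (2 • t) = ∫ t, G t := by
    have h := integral_map (μ := volume) measurePreserving_two_nsmul.measurable.aemeasurable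
      (f := G) (by rw [measurePreserving_two_nsmul.map_eq]; exact hG.aestronglyMeasurable)
    rw [measurePreserving_two_nsmul.map_eq] at h
    exact h.symm
  have heq : ∫ t in halfCircle, G (2 • t) = ∫ t in halfCircleᶜ, G (2 • t) := by
    rw [← integral_indicator measurableSet_halfCircle,
      ← integral_indicator measurableSet_halfCircle.compl,
      ← integral_add_right_eq_self _ ((1 / 2 : ℝ) : UnitAddCircle)]
    congr 1
    ext t
    by_cases h : t ∈ halfCircle
    · rw [indicator_of_notMem (by rw [add_half_mem_halfCircle]; exact not_not.mpr h),
        indicator_of_notMem (not_not.mpr h)]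
    · rw [indicator_of_mem ((add_half_mem_halfCircle t).mpr h), indicator_of_mem h,
        two_nsmul_add_half]
  constructor <;> linarith

open Classical in
theorem integrable_piecewise_two_nsmul {G H : UnitAddCircle → ℝ} (hG : Integrable G)
    (hH : Integrable H) :
    Integrable (fun t => if t ∈ halfCircle then G (2 • t) else H (2 • t)) :=
  Integrable.piecewise measurableSet_halfCircle
    ((measurePreserving_two_nsmul.integrable_comp hG.aestronglyMeasurable).mpr hG).integrableOn
    ((measurePreserving_two_nsmul.integrable_comp hH.aestronglyMeasurable).mpr hH).integrableOn

open Classical in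
theorem integral_piecewise_two_nsmul {G H : UnitAddCircle → ℝ} (hG : Integrable G)
    (hH : Integrable H) :
    ∫ t, (if t ∈ halfCircle then G (2 • t) else H (2 • t)) = (∫ t, (G t + H t)) / 2 := by
  have h := integral_piecewise (μ := volume) measurableSet_halfCircle
    ((measurePreserving_two_nsmul.integrable_comp hG.aestronglyMeasurable).mpr hG).integrableOn
    ((measurePreserving_two_nsmul.integrable_comp hH.aestronglyMeasurable).mpr hH).integrableOn
  rw [integral_add hG hH, add_div, ← (setIntegral_halfCircle_comp hG).1,
    ← (setIntegral_halfCircle_comp hH).2]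
  exact h

end Circle

/-! ### Alspach's fixed point free isometry -/

section Alspach

/-- The lower branch of Alspach's map. -/
def lowerBranch (s : ℝ) : ℝ := min (2 * s) 1

/-- The upper branch of Alspach's map. -/
def upperBranch (s : ℝ) : ℝ := max (2 * s - 1) 0

theorem lowerBranch_add_upperBranch (s : ℝ) : lowerBranch s + upperBranch s = 2 * s := by
  unfold lowerBranch upperBranch
  rcases le_total (2 * s) 1 with h | h
  · rw [min_eq_left h, max_eq_right (by linarith), add_zero]
  · rw [min_eq_right h, max_eq_left (by linarith)]
    ring

theorem monotone_lowerBranch : Monotone lowerBranch := fun a b h => by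
  unfold lowerBranch
  gcongr

theorem monotone_upperBranch : Monotone upperBranch := fun a b h => by
  unfold upperBranch
  gcongr

/-- Both branches are monotone, so their increments have the same sign and the absolute values add
like the increments themselves. This makes Alspach's map an isometry. -/
theorem abs_branch_sub_add (a b : ℝ) :
    |lowerBranch a - lowerBranch b| + |upperBranch a - upperBranch b| = 2 * |a - b| := by
  have ha := lowerBranch_add_upperBranch a
  have hb := lowerBranch_add_upperBranch b
  rcases le_total a b with h | h
  · rw [abs_of_nonpos (sub_nonpos.mpr (monotone_lowerBranch h)),
      abs_of_nonpos (sub_nonpos.mpr (monotone_upperBranch h)), abs_of_nonpos (sub_nonpos.mpr h)]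
    linarith
  · rw [abs_of_nonneg (sub_nonneg.mpr (monotone_lowerBranch h)),
      abs_of_nonneg (sub_nonneg.mpr (monotone_upperBranch h)), abs_of_nonneg (sub_nonneg.mpr h)]
    linarith

theorem lowerBranch_mem {s : ℝ} (hs : s ∈ Icc (0 : ℝ) 1) : lowerBranch s ∈ Icc (0 : ℝ) 1 :=
  ⟨le_min (by linarith [hs.1]) zero_le_one, min_le_right _ _⟩

theorem upperBranch_mem {s : ℝ} (hs : s ∈ Icc (0 : ℝ) 1) : upperBranch s ∈ Icc (0 : ℝ) 1 :=
  ⟨le_max_right _ _, max_le (by linarith [hs.2]) zero_le_one⟩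

/-- Passing to the branches lowers the average of `s(1 - s)` by a square that vanishes only at `s =
0` and `s = 1`. -/
theorem branch_defect (s : ℝ) :
    s * (1 - s) - (lowerBranch s * (1 - lowerBranch s) + upperBranch s * (1 - upperBranch s)) / 2
      = min s (1 - s) ^ 2 := by
  unfold lowerBranch upperBranch
  rcases le_total (2 * s) 1 with h | h
  · rw [min_eq_left h, max_eq_right (by linarith), min_eq_left (by linarith)]
    ring
  · rw [min_eq_right h, max_eq_left (by linarith), min_eq_right (by linarith)]
    ring

theorem lowerBranch_of_zero_or_one {s : ℝ} (hs : s = 0 ∨ s = 1) : lowerBranch s = s := by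
  unfold lowerBranch
  rcases hs with rfl | rfl <;> norm_num

theorem upperBranch_of_zero_or_one {s : ℝ} (hs : s = 0 ∨ s = 1) : upperBranch s = s := by
  unfold upperBranch
  rcases hs with rfl | rfl <;> norm_num

theorem integrable_lowerBranch {f : UnitAddCircle → ℝ} (hf : Integrable f) :
    Integrable fun t => lowerBranch (f t) :=
  (hf.const_mul 2).inf (integrable_const 1)

theorem integrable_upperBranch {f : UnitAddCircle → ℝ} (hf : Integrable f) :
    Integrable fun t => upperBranch (f t) :=
  ((hf.const_mul 2).sub (integrable_const 1)).sup (integrable_const 0)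

open Classical in
/-- Alspach's transformation on functions. -/
def alspachFun (f : UnitAddCircle → ℝ) (t : UnitAddCircle) : ℝ :=
  if t ∈ halfCircle then lowerBranch (f (2 • t)) else upperBranch (f (2 • t))

theorem integrable_alspachFun {f : UnitAddCircle → ℝ} (hf : Integrable f) :
    Integrable (alspachFun f) := by
  have h := integrable_piecewise_two_nsmul (G := fun t => lowerBranch (f t))
    (H := fun t => upperBranch (f t)) (integrable_lowerBranch hf) (integrable_upperBranch hf)
  exact h

theorem integral_alspachFun {f : UnitAddCircle → ℝ} (hf : Integrable f) :
    ∫ t, alspachFun f t = ∫ t, f t := by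
  have h := integral_piecewise_two_nsmul (integrable_lowerBranch hf) (integrable_upperBranch hf)
  simp only [lowerBranch_add_upperBranch, integral_const_mul] at h
  rw [mul_div_cancel_left₀ _ two_ne_zero] at h
  exact h

theorem integral_abs_alspachFun_sub {f g : UnitAddCircle → ℝ} (hf : Integrable f)
    (hg : Integrable g) :
    ∫ t, |alspachFun f t - alspachFun g t| = ∫ t, |f t - g t| := by
  classical
  have h := integral_piecewise_two_nsmul
    ((integrable_lowerBranch hf).sub (integrable_lowerBranch hg)).abs
    ((integrable_upperBranch hf).sub (integrable_upperBranch hg)).abs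
  simp only [Pi.sub_apply, abs_branch_sub_add, integral_const_mul] at h
  rw [mul_div_cancel_left₀ _ two_ne_zero] at h
  rw [← h]
  congr 1
  ext t
  unfold alspachFun
  split_ifs <;> rfl

theorem alspachFun_ae_mem {f : UnitAddCircle → ℝ} (hf : ∀ᵐ t, f t ∈ Icc (0 : ℝ) 1) :
    ∀ᵐ t, alspachFun f t ∈ Icc (0 : ℝ) 1 := by
  filter_upwards [measurePreserving_two_nsmul.quasiMeasurePreserving.ae hf] with t ht
  unfold alspachFun
  split_ifs
  · exact lowerBranch_mem ht
  · exact upperBranch_mem ht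

theorem integrable_mul_one_sub {f : UnitAddCircle → ℝ} (hf : Integrable f)
    (h01 : ∀ᵐ t, f t ∈ Icc (0 : ℝ) 1) : Integrable fun t => f t * (1 - f t) := by
  refine Integrable.of_bound (hf.aestronglyMeasurable.mul
    (aestronglyMeasurable_const.sub hf.aestronglyMeasurable)) 1 ?_
  filter_upwards [h01] with t ht
  have h0 : 0 ≤ 1 - f t := by linarith [ht.2]
  rw [Real.norm_eq_abs, abs_of_nonneg (mul_nonneg ht.1 h0)]
  exact mul_le_one₀ ht.2 h0 (by linarith [ht.1])

/-- For a fixed point, `∫ f(1 - f)` equals the average over the two branches, so the defect in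
`branch_defect` integrates to zero; being nonnegative, it vanishes a.e. -/
theorem alspachFun_fixed_ae_zero_or_one {f : UnitAddCircle → ℝ} (hf : Integrable f)
    (h01 : ∀ᵐ t, f t ∈ Icc (0 : ℝ) 1) (hfix : alspachFun f =ᵐ[volume] f) :
    ∀ᵐ t, f t = 0 ∨ f t = 1 := by
  classical
  have hl := integrable_mul_one_sub (integrable_lowerBranch hf)
    (h01.mono fun t => lowerBranch_mem)
  have hu := integrable_mul_one_sub (integrable_upperBranch hf)
    (h01.mono fun t => upperBranch_mem)
  have hi := integrable_mul_one_sub hf h01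
  have h1 : ∫ t, f t * (1 - f t) = (∫ t, (lowerBranch (f t) * (1 - lowerBranch (f t)) +
      upperBranch (f t) * (1 - upperBranch (f t)))) / 2 := by
    rw [← integral_piecewise_two_nsmul hl hu]
    apply integral_congr_ae
    filter_upwards [hfix] with t ht
    rw [← ht]
    unfold alspachFun
    split_ifs <;> rfl
  have hlu : Integrable fun t => (lowerBranch (f t) * (1 - lowerBranch (f t)) +
      upperBranch (f t) * (1 - upperBranch (f t))) / 2 := (hl.add hu).div_const 2
  have h2 : ∫ t, min (f t) (1 - f t) ^ 2 = 0 := by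
    simp_rw [← branch_defect]
    rw [integral_sub hi hlu, h1, integral_div, sub_self]
  have h3 : Integrable fun t => min (f t) (1 - f t) ^ 2 := by
    simp_rw [← branch_defect]
    exact hi.sub hlu
  rw [integral_eq_zero_iff_of_nonneg (fun t => sq_nonneg _) h3] at h2
  filter_upwards [h2] with t ht
  have h4 : min (f t) (1 - f t) = 0 := pow_eq_zero_iff two_ne_zero |>.mp ht
  rcases min_choice (f t) (1 - f t) with h | h
  · exact Or.inl (h ▸ h4)
  · exact Or.inr (by rw [h] at h4; linarith)

theorem integral_of_alspachFun_fixed {f : UnitAddCircle → ℝ} (hf : Integrable f)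
    (h01 : ∀ᵐ t, f t ∈ Icc (0 : ℝ) 1) (hfix : alspachFun f =ᵐ[volume] f) :
    ∫ t, f t = 0 ∨ ∫ t, f t = 1 := by
  have h1 := alspachFun_fixed_ae_zero_or_one hf h01 hfix
  -- Both branches fix `0` and `1`, so the fixed point equation reduces to invariance under
  -- doubling.
  have h2 : f ∘ (fun t : UnitAddCircle => 2 • t) =ᵐ[volume] f := by
    filter_upwards [hfix, measurePreserving_two_nsmul.quasiMeasurePreserving.ae h1] with t h3 h4
    rw [← h3]
    unfold alspachFun
    rw [lowerBranch_of_zero_or_one h4, upperBranch_of_zero_or_one h4, ite_self]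
    rfl
  -- Ergodicity makes `f` a constant `c`, which must itself be `0` or `1`.
  obtain ⟨c, hc⟩ := (AddCircle.ergodic_nsmul (T := 1) one_lt_two).quasiErgodic.ae_eq_const_of_ae_eq_comp₀
    hf.aestronglyMeasurable.aemeasurable.nullMeasurable h2
  have h3 : ∫ t, f t = c := by
    rw [integral_congr_ae hc]
    simp
  obtain ⟨t, h4, h5⟩ := (h1.and hc).exists
  rw [h3]
  have h6 : f t = c := h5
  rwa [h6] at h4

/-- Alspach's transformation of `L¹`. -/
def alspach (f : Lp ℝ 1 (volume : Measure UnitAddCircle)) :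
    Lp ℝ 1 (volume : Measure UnitAddCircle) :=
  (integrable_alspachFun (L1.integrable_coeFn f)).toL1 _

theorem coeFn_alspach (f : Lp ℝ 1 (volume : Measure UnitAddCircle)) :
    alspach f =ᵐ[volume] alspachFun f :=
  Integrable.coeFn_toL1 _

theorem alspach_mem {f : Lp ℝ 1 (volume : Measure UnitAddCircle)} {m : ℝ}
    (hf : f ∈ unitIntervalFunctions volume m) : alspach f ∈ unitIntervalFunctions volume m := by
  refine ⟨?_, ?_⟩
  · filter_upwards [coeFn_alspach f, alspachFun_ae_mem hf.1] with t h1 h2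
    rwa [h1]
  · rw [integral_congr_ae (coeFn_alspach f), integral_alspachFun (L1.integrable_coeFn f), hf.2]

theorem norm_sub_eq_integral {Ω : Type*} [MeasurableSpace Ω] {μ : Measure Ω} (f g : Lp ℝ 1 μ) :
    ‖f - g‖ = ∫ t, |f t - g t| ∂μ := by
  rw [L1.norm_eq_integral_norm]
  apply integral_congr_ae
  filter_upwards [Lp.coeFn_sub f g] with t ht
  rw [ht]
  rfl

theorem norm_alspach_sub (f g : Lp ℝ 1 (volume : Measure UnitAddCircle)) :
    ‖alspach f - alspach g‖ = ‖f - g‖ := by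
  rw [norm_sub_eq_integral, norm_sub_eq_integral, ← integral_abs_alspachFun_sub
    (L1.integrable_coeFn f) (L1.integrable_coeFn g)]
  apply integral_congr_ae
  filter_upwards [coeFn_alspach f, coeFn_alspach g] with t h1 h2
  rw [h1, h2]

/-- Alspach's theorem: `L¹` fails the weak fixed point property. -/
theorem not_weakFixedPointProperty_L1_circle :
    ¬ WeakFixedPointProperty (Lp ℝ 1 (volume : Measure UnitAddCircle)) := by
  intro h
  have hne : (unitIntervalFunctions (volume : Measure UnitAddCircle) (1 / 2)).Nonempty := by
    have hc := Lp.coeFn_const 1 (volume : Measure UnitAddCircle) (1 / 2 : ℝ)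
    refine ⟨Lp.const 1 volume (1 / 2 : ℝ), ?_, ?_⟩
    · filter_upwards [hc] with t ht
      rw [ht]
      constructor <;> norm_num
    · rw [integral_congr_ae hc]
      simp
  obtain ⟨⟨f, hf⟩, hfix⟩ := h _ hne (isCompact_unitIntervalFunctions _)
    (convex_ae_mem_Icc_integral_eq le_rfl _) (fun f => ⟨alspach f, alspach_mem f.2⟩)
    (fun f g => (norm_alspach_sub f g).le)
  have hfix2 : alspach f = f := congrArg Subtype.val hfix
  have hae : alspachFun f =ᵐ[volume] f := by
    have h1 := coeFn_alspach f
    rw [hfix2] at h1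
    exact h1.symm
  have h2 := integral_of_alspachFun_fixed (L1.integrable_coeFn f) hf.1 hae
  rw [hf.2] at h2
  norm_num at h2

instance : TopologicalSpace.SeparableSpace (Lp ℝ 1 (volume : Measure UnitAddCircle)) := by
  have : Fact ((1 : ℝ≥0∞) ≠ ∞) := ⟨ENNReal.one_ne_top⟩
  have := Lp.SecondCountableTopology (E := ℝ) (μ := (volume : Measure UnitAddCircle)) (p := 1)
  infer_instance

end Alspach

/-! ### Embedding `L¹` of the circle into `L⁰(I)` -/

section Embeddings

variable {I : BaseInterval}

/-- The linear map into `L⁰` induced by a family of functions that is linear up to null sets. -/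
def linearToL0 {E : Type*} [AddCommGroup E] [Module ℝ E] (F : E → ℝ → ℝ)
    (hm : ∀ x, AEStronglyMeasurable (F x) I.measure)
    (hadd : ∀ x y, F (x + y) =ᵐ[I.measure] F x + F y)
    (hsmul : ∀ (c : ℝ) x, F (c • x) =ᵐ[I.measure] c • F x) : E →ₗ[ℝ] I.L0 where
  toFun x := AEEqFun.mk (F x) (hm x)
  map_add' x y := by
    rw [AEEqFun.mk_add_mk, AEEqFun.mk_eq_mk]
    exact hadd x y
  map_smul' c x :=
    (AEEqFun.mk_eq_mk.mpr (hsmul c x)).trans (AEEqFun.smul_mk c (F x) (hm x))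

theorem SublinearOperator.not_weakFixedPointProperty_domain {E : Type*} [NormedAddCommGroup E]
    [NormedSpace ℝ E] (hE : ¬ WeakFixedPointProperty E) (T : SublinearOperator I)
    (X : BanachFunctionSpace I) (L : E →ₗ[ℝ] I.L0) {c : ℝ} (hc : 0 < c)
    (hfin : ∀ f, ∀ᵐ x ∂I.measure, T.toFun (L f) x ≠ ∞)
    (hmem : ∀ f, T.toL0 (L f) ∈ X.toSubmodule)
    (hnorm : ∀ f, X.norm ⟨T.toL0 (L f), hmem f⟩ = c * ‖f‖) :
    ¬ WeakFixedPointProperty (T.Domain X) :=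
  not_weakFixedPointProperty_of_embedding (F := T.Domain X)
    (L.codRestrict (T.domainSubmodule X) fun f => ⟨hfin f, hmem f⟩) hc hnorm hE

/-- Allows the norm to be computed from the `[0,∞]`-valued function `T.toFun`, where Tonelli applies
directly; finiteness a.e. transfers it to the real-valued class. -/
theorem SublinearOperator.not_weakFixedPointProperty_domain_lebesgueSpace {E : Type*}
    [NormedAddCommGroup E] [NormedSpace ℝ E] (hE : ¬ WeakFixedPointProperty E)
    (T : SublinearOperator I) (p : ℝ≥0∞) [Fact (1 ≤ p)] (L : E →ₗ[ℝ] I.L0)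
    (hfin : ∀ f, ∀ᵐ x ∂I.measure, T.toFun (L f) x ≠ ∞)
    (hnorm : ∀ f, eLpNorm (T.toFun (L f)) p I.measure = ENNReal.ofReal ‖f‖) :
    ¬ WeakFixedPointProperty (T.Domain (lebesgueSpace I p)) := by
  have hnorm2 : ∀ f, eLpNorm (T.toL0 (L f)) p I.measure = ENNReal.ofReal ‖f‖ := by
    intro f
    rw [← hnorm f]
    apply eLpNorm_congr_enorm_ae
    filter_upwards [T.coe_toL0 (L f), hfin f] with x h1 h2
    rw [h1, Real.enorm_eq_ofReal ENNReal.toReal_nonneg, ENNReal.ofReal_toReal h2, enorm_eq_self]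
  refine T.not_weakFixedPointProperty_domain hE _ L one_pos hfin (fun f => ?_) fun f => ?_
  · refine Lp.mem_Lp_iff_eLpNorm_lt_top.mpr ?_
    rw [hnorm2]
    exact ENNReal.ofReal_lt_top
  · change (eLpNorm (T.toL0 (L f)) p I.measure).toReal = _
    rw [hnorm2, ENNReal.toReal_ofReal (norm_nonneg f), one_mul]

theorem BaseInterval.toSet_nonneg {x : ℝ} (hx : x ∈ I.toSet) : 0 ≤ x := by
  cases I
  · exact hx.1
  · exact hx

theorem BaseInterval.Ioc_subset_toSet : Ioc (0 : ℝ) 1 ⊆ I.toSet := by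
  intro x hx
  cases I
  · exact ⟨hx.1.le, hx.2⟩
  · exact hx.1.le

theorem BaseInterval.Icc_subset_toSet {x : ℝ} (hx : x ∈ I.toSet) : Icc 0 x ⊆ I.toSet := by
  intro y hy
  cases I
  · exact ⟨hy.1, hy.2.trans hx.2⟩
  · exact hy.1

theorem BaseInterval.ae_pos (I : BaseInterval) : ∀ᵐ x ∂I.measure, 0 < x ∧ x ∈ I.toSet := by
  filter_upwards [ae_restrict_mem I.measurableSet_toSet,
    ae_restrict_of_ae (Measure.ae_ne volume (0 : ℝ))] with x h1 h2
  exact ⟨lt_of_le_of_ne (toSet_nonneg h1) (Ne.symm h2), h1⟩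

/-- A function on the circle, read on `(0,1]` and multiplied by a weight. -/
def weightedPullback (w : ℝ → ℝ) (f : UnitAddCircle → ℝ) : ℝ → ℝ :=
  (Ioc 0 1).indicator fun t => w t * f (t : UnitAddCircle)

theorem ae_coe_circle {P : UnitAddCircle → Prop} (h : ∀ᵐ t, P t) :
    ∀ᵐ t : ℝ, t ∈ Ioc (0 : ℝ) 1 → P t := by
  have h1 := (UnitAddCircle.measurePreserving_mk 0).quasiMeasurePreserving.ae h
  rw [zero_add, ae_restrict_iff' measurableSet_Ioc] at h1
  exact h1

theorem weightedPullback_congr (w : ℝ → ℝ) {f g : UnitAddCircle → ℝ} (h : f =ᵐ[volume] g) :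
    weightedPullback w f =ᵐ[I.measure] weightedPullback w g := by
  refine ae_restrict_of_ae ?_
  filter_upwards [ae_coe_circle h] with t ht
  unfold weightedPullback
  by_cases h1 : t ∈ Ioc (0 : ℝ) 1
  · rw [indicator_of_mem h1, indicator_of_mem h1, ht h1]
  · rw [indicator_of_notMem h1, indicator_of_notMem h1]

variable (I) in
/-- The embedding of `L¹` of the circle into `L⁰(I)` by a weight. -/
def circleToL0 (w : ℝ → ℝ) (hw : Measurable w) :
    Lp ℝ 1 (volume : Measure UnitAddCircle) →ₗ[ℝ] I.L0 :=
  linearToL0 (fun f => weightedPullback w f)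
    (fun f => ((hw.mul ((Lp.stronglyMeasurable f).measurable.comp
      AddCircle.measurable_mk')).indicator measurableSet_Ioc).aestronglyMeasurable)
    (fun f g => (weightedPullback_congr w (Lp.coeFn_add f g)).trans (ae_of_all _ fun t => by
      simp only [weightedPullback, Pi.add_apply, mul_add]
      exact congrFun (indicator_add _ _ _) t))
    (fun c f => (weightedPullback_congr w (Lp.coeFn_smul c f)).trans (ae_of_all _ fun t => by
      simp only [weightedPullback, Pi.smul_apply, smul_eq_mul, mul_left_comm _ c]
      exact indicator_const_mul _ _ _ t))

theorem coeFn_circleToL0 (w : ℝ → ℝ) (hw : Measurable w)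
    (f : Lp ℝ 1 (volume : Measure UnitAddCircle)) :
    circleToL0 I w hw f =ᵐ[I.measure] weightedPullback w f :=
  AEEqFun.coeFn_mk _ _

/-- The weights `w` and `v` cancel, and `(0,1]` maps onto the circle preserving measure. -/
theorem lintegral_circleToL0_mul (w : ℝ → ℝ) (hw : Measurable w) (v : ℝ → ℝ≥0∞)
    (hvw : ∀ t ∈ Ioo (0 : ℝ) 1, ‖w t‖ₑ * v t = 1)
    (f : Lp ℝ 1 (volume : Measure UnitAddCircle)) :
    ∫⁻ t, ‖circleToL0 I w hw f t‖ₑ * v t ∂I.measure = ENNReal.ofReal ‖f‖ := by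
  have h1 : ∫⁻ t, ‖circleToL0 I w hw f t‖ₑ * v t ∂I.measure =
      ∫⁻ t, (Ioc (0 : ℝ) 1).indicator (fun t => ‖f (t : UnitAddCircle)‖ₑ) t ∂I.measure := by
    apply lintegral_congr_ae
    -- The point `1` is discarded because the weight `log (1/t)` vanishes there.
    filter_upwards [coeFn_circleToL0 w hw f,
      ae_restrict_of_ae (Measure.ae_ne volume (1 : ℝ))] with t h1 h2
    rw [h1]
    unfold weightedPullback
    by_cases h3 : t ∈ Ioc (0 : ℝ) 1
    · rw [indicator_of_mem h3, indicator_of_mem h3, enorm_mul, mul_right_comm,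
        hvw t ⟨h3.1, lt_of_le_of_ne h3.2 h2⟩, one_mul]
    · rw [indicator_of_notMem h3, indicator_of_notMem h3, enorm_zero, zero_mul]
  rw [h1, lintegral_indicator measurableSet_Ioc, Measure.restrict_restrict measurableSet_Ioc,
    inter_eq_left.mpr Ioc_subset_toSet]
  have h2 := UnitAddCircle.lintegral_preimage 0 fun t => ‖f t‖ₑ
  rw [zero_add] at h2
  rw [h2, ← eLpNorm_one_eq_lintegral_enorm, Lp.norm_def, ENNReal.ofReal_toReal]
  exact Lp.eLpNorm_ne_top f

end Embeddings

/-! ### Cesàro and Copson norms as weighted `L¹` norms -/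

section Integrals

variable {I : BaseInterval}

theorem copsonFun_eq_lintegral (g : I.L0) (x : ℝ) :
    copsonFun g x = ∫⁻ t, {p : ℝ × ℝ | p.1 ≤ p.2}.indicator
      (fun p => ‖g p.2‖ₑ / ENNReal.ofReal p.2) (x, t) ∂I.measure := by
  unfold copsonFun
  rw [inter_comm, ← Measure.restrict_restrict measurableSet_Ici,
    ← lintegral_indicator measurableSet_Ici]
  rfl

/-- By Tonelli, `|g t| / t` is integrated over `0 ≤ x ≤ t`, a set of measure `t`, which cancels the
denominator. -/
theorem lintegral_copsonFun (g : I.L0) :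
    ∫⁻ x, copsonFun g x ∂I.measure = ∫⁻ t, ‖g t‖ₑ ∂I.measure := by
  simp_rw [copsonFun_eq_lintegral]
  rw [lintegral_lintegral_swap]
  · apply lintegral_congr_ae
    filter_upwards [I.ae_pos] with t ht
    have h1 : ∀ x, {p : ℝ × ℝ | p.1 ≤ p.2}.indicator
        (fun p => ‖g p.2‖ₑ / ENNReal.ofReal p.2) (x, t) =
        (Iic t).indicator (fun _ => ‖g t‖ₑ / ENNReal.ofReal t) x := fun x => rfl
    simp_rw [h1]
    rw [lintegral_indicator measurableSet_Iic, setLIntegral_const,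
      Measure.restrict_apply measurableSet_Iic]
    have h2 : Iic t ∩ I.toSet = Icc 0 t := by
      ext x
      exact ⟨fun h => ⟨toSet_nonneg h.2, h.1⟩, fun h => ⟨h.2, Icc_subset_toSet ht.2 h⟩⟩
    rw [h2, Real.volume_Icc, sub_zero]
    exact ENNReal.div_mul_cancel (ENNReal.ofReal_pos.mpr ht.1).ne' ENNReal.ofReal_ne_top
  · refine AEMeasurable.indicator ?_ (measurableSet_le measurable_fst measurable_snd)
    exact AEMeasurable.comp_snd (f := fun t => ‖g t‖ₑ / ENNReal.ofReal t)
      (aemeasurable_div_restrict g Subset.rfl)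

theorem lintegral_inv_Icc {t : ℝ} (h0 : 0 < t) (h1 : t ≤ 1) :
    ∫⁻ x in Icc t 1, (ENNReal.ofReal x)⁻¹ = ENNReal.ofReal (Real.log t⁻¹) := by
  have h2 : IntervalIntegrable (fun x : ℝ => x⁻¹) volume t 1 := by
    refine intervalIntegral.intervalIntegrable_inv (fun x hx => ?_) continuousOn_id
    rw [uIcc_of_le h1] at hx
    exact (h0.trans_le hx.1).ne'
  have h3 := integral_inv_of_pos h0 one_pos
  rw [intervalIntegral.integral_of_le h1, one_div] at h3
  rw [← h3, ofReal_integral_eq_lintegral_ofReal ((intervalIntegrable_iff_integrableOn_Ioc_of_le h1).mp h2),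
    setLIntegral_congr Ioc_ae_eq_Icc.symm]
  · refine setLIntegral_congr_fun measurableSet_Ioc fun x hx => ?_
    exact (ENNReal.ofReal_inv_of_pos (h0.trans hx.1)).symm
  · filter_upwards [ae_restrict_mem measurableSet_Ioc] with x hx
    exact inv_nonneg.mpr (h0.trans hx.1).le

theorem cesaroFun_eq_lintegral (g : BaseInterval.unit.L0) {x : ℝ} (hx : 0 < x) :
    cesaroFun g x = ∫⁻ t, {p : ℝ × ℝ | p.2 ≤ p.1}.indicator
      (fun p => (ENNReal.ofReal p.1)⁻¹ * ‖g p.2‖ₑ) (x, t) ∂BaseInterval.unit.measure := by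
  unfold cesaroFun
  have h : BaseInterval.unit.toSet ∩ Icc 0 x = Iic x ∩ BaseInterval.unit.toSet := by
    ext t
    exact ⟨fun h => ⟨h.2.2, h.1⟩, fun h => ⟨h.2, h.2.1, h.1⟩⟩
  rw [h, ← Measure.restrict_restrict measurableSet_Iic, ← lintegral_const_mul' _ _
    (ENNReal.inv_ne_top.mpr (ENNReal.ofReal_pos.mpr hx).ne'),
    ← lintegral_indicator measurableSet_Iic]
  rfl

/-- By Tonelli, the weight at `t` is `∫_t^1 dx/x = log (1/t)`. On the half-line the corresponding
integral diverges. -/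
theorem lintegral_cesaroFun_unit (g : BaseInterval.unit.L0) :
    ∫⁻ x, cesaroFun g x ∂BaseInterval.unit.measure =
      ∫⁻ t, ‖g t‖ₑ * ENNReal.ofReal (Real.log t⁻¹) ∂BaseInterval.unit.measure := by
  rw [lintegral_congr_ae (BaseInterval.unit.ae_pos.mono fun x hx => cesaroFun_eq_lintegral g hx.1),
    lintegral_lintegral_swap]
  · apply lintegral_congr_ae
    filter_upwards [BaseInterval.unit.ae_pos] with t ht
    have h1 : ∀ x, {p : ℝ × ℝ | p.2 ≤ p.1}.indicator
        (fun p => (ENNReal.ofReal p.1)⁻¹ * ‖g p.2‖ₑ) (x, t) =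
        (Ici t).indicator (fun x => (ENNReal.ofReal x)⁻¹ * ‖g t‖ₑ) x := fun x => rfl
    simp_rw [h1]
    have h2 : Ici t ∩ BaseInterval.unit.toSet = Icc t 1 := by
      ext x
      exact ⟨fun h => ⟨h.1, h.2.2⟩, fun h => ⟨h.1, ht.1.le.trans h.1, h.2⟩⟩
    rw [lintegral_indicator measurableSet_Ici, Measure.restrict_restrict measurableSet_Ici, h2,
      lintegral_mul_const' _ _ enorm_ne_top, lintegral_inv_Icc ht.1 ht.2.2, mul_comm]
  · refine AEMeasurable.indicator ?_ (measurableSet_le measurable_snd measurable_fst)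
    exact (ENNReal.measurable_ofReal.comp measurable_fst).inv.aemeasurable.mul
      (AEMeasurable.comp_snd (f := fun t => ‖g t‖ₑ) (aemeasurable_restrict g Subset.rfl).enorm)

/-- The Copson function is nonincreasing, so its essential supremum is its limit at `0`, which by
monotone convergence is the full integral. -/
theorem essSup_copsonFun (g : I.L0) :
    essSup (copsonFun g) I.measure = ∫⁻ t, ‖g t‖ₑ / ENNReal.ofReal t ∂I.measure := by
  apply le_antisymm
  · exact essSup_le_of_ae_le _ (ae_of_all _ fun x => lintegral_mono_set inter_subset_left)
  · let s : ℕ → Set ℝ := fun n => I.toSet ∩ Ici (1 / ((n : ℝ) + 1))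
    have hmono : Monotone s := by
      intro m n hmn
      refine inter_subset_inter_right _ (Ici_subset_Ici.mpr ?_)
      exact one_div_le_one_div_of_le (by positivity) (by gcongr)
    have hunion : ∀ᵐ t ∂I.measure, t ∈ ⋃ n, s n := by
      filter_upwards [I.ae_pos] with t ht
      obtain ⟨n, hn⟩ := exists_nat_one_div_lt ht.1
      exact mem_iUnion.mpr ⟨n, ht.2, hn.le⟩
    have h1 : ∫⁻ t, ‖g t‖ₑ / ENNReal.ofReal t ∂I.measure =
        ∫⁻ t in ⋃ n, s n, ‖g t‖ₑ / ENNReal.ofReal t := by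
      have h2 : (⋃ n, s n) ⊆ I.toSet := iUnion_subset fun n => inter_subset_left
      rw [← inter_eq_left.mpr h2, ← Measure.restrict_restrict
        (MeasurableSet.iUnion fun n => I.measurableSet_toSet.inter measurableSet_Ici),
        Measure.restrict_eq_self_of_ae_mem hunion]
    rw [h1, setLIntegral_iUnion_of_directed _ hmono.directed_le]
    refine iSup_le fun n => ?_
    -- Almost every point satisfies the essential supremum bound, so one exists to the left of the
    -- `n`-th cutoff; its tail integral dominates the one over `s n`.
    obtain ⟨x, -, hx, hP⟩ := I.exists_pos_lt (a := 1 / ((n : ℝ) + 1)) (by positivity)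
      (ENNReal.ae_le_essSup (copsonFun g))
    exact le_trans (lintegral_mono_set (inter_subset_inter_right _ (Ici_subset_Ici.mpr hx.le))) hP

end Integrals

/-! ### The spaces containing `L¹`: `Ces_1[0,1]`, `Cop_1`, `Cop_∞` -/

section WeightedL1

variable {I : BaseInterval}

theorem not_weakFixedPointProperty_of_eLpNorm_eq (T : SublinearOperator I) (p : ℝ≥0∞)
    [Fact (1 ≤ p)] (w : ℝ → ℝ) (hw : Measurable w) (v : ℝ → ℝ≥0∞)
    (hvw : ∀ t ∈ Ioo (0 : ℝ) 1, ‖w t‖ₑ * v t = 1)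
    (hT : ∀ g, eLpNorm (T.toFun g) p I.measure = ∫⁻ t, ‖g t‖ₑ * v t ∂I.measure)
    (hfin : ∀ g, eLpNorm (T.toFun g) p I.measure ≠ ∞ → ∀ᵐ x ∂I.measure, T.toFun g x ≠ ∞) :
    ¬ WeakFixedPointProperty (T.Domain (lebesgueSpace I p)) := by
  have h : ∀ f, eLpNorm (T.toFun (circleToL0 I w hw f)) p I.measure = ENNReal.ofReal ‖f‖ :=
    fun f => (hT _).trans (lintegral_circleToL0_mul w hw v hvw f)
  exact T.not_weakFixedPointProperty_domain_lebesgueSpace not_weakFixedPointProperty_L1_circle p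
    (circleToL0 I w hw) (fun f => hfin _ (by rw [h]; exact ENNReal.ofReal_ne_top)) h

theorem SublinearOperator.ae_ne_top_of_eLpNorm_one (T : SublinearOperator I) (g : I.L0)
    (h : eLpNorm (T.toFun g) 1 I.measure ≠ ∞) : ∀ᵐ x ∂I.measure, T.toFun g x ≠ ∞ := by
  rw [eLpNorm_one_eq_lintegral_enorm] at h
  exact (ae_lt_top (T.measurable_toFun g) h).mono fun x hx => hx.ne

theorem SublinearOperator.ae_ne_top_of_eLpNorm_top (T : SublinearOperator I) (g : I.L0)
    (h : eLpNorm (T.toFun g) ∞ I.measure ≠ ∞) : ∀ᵐ x ∂I.measure, T.toFun g x ≠ ∞ := by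
  rw [eLpNorm_exponent_top] at h
  exact (ENNReal.ae_le_essSup (T.toFun g)).mono fun x hx => ne_top_of_le_ne_top h hx

theorem not_weakFixedPointProperty_Ces_unit_one :
    ¬ WeakFixedPointProperty (Ces BaseInterval.unit 1) := by
  refine not_weakFixedPointProperty_of_eLpNorm_eq (cesaro BaseInterval.unit) 1
    (fun t => (Real.log t⁻¹)⁻¹) (Real.measurable_log.comp measurable_inv).inv
    (fun t => ENNReal.ofReal (Real.log t⁻¹)) (fun t ht => ?_) (fun g => ?_)
    (SublinearOperator.ae_ne_top_of_eLpNorm_one _)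
  · have h : 0 < Real.log t⁻¹ := Real.log_pos ((one_lt_inv₀ ht.1).mpr ht.2)
    rw [Real.enorm_eq_ofReal (inv_pos.mpr h).le, ← ENNReal.ofReal_mul (inv_pos.mpr h).le,
      inv_mul_cancel₀ h.ne', ENNReal.ofReal_one]
  · rw [eLpNorm_one_eq_lintegral_enorm]
    exact lintegral_cesaroFun_unit g

theorem not_weakFixedPointProperty_Cop_one (I : BaseInterval) :
    ¬ WeakFixedPointProperty (Cop I 1) := by
  refine not_weakFixedPointProperty_of_eLpNorm_eq (copson I) 1
    (fun _ => 1) measurable_const (fun _ => 1) (fun t ht => by simp) (fun g => ?_)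
    (SublinearOperator.ae_ne_top_of_eLpNorm_one _)
  rw [eLpNorm_one_eq_lintegral_enorm]
  simp_rw [mul_one]
  exact lintegral_copsonFun g

theorem not_weakFixedPointProperty_Cop_top (I : BaseInterval) :
    ¬ WeakFixedPointProperty (Cop I ∞) := by
  refine not_weakFixedPointProperty_of_eLpNorm_eq (copson I) ∞
    (fun t => t) measurable_id (fun t => (ENNReal.ofReal t)⁻¹) (fun t ht => ?_) (fun g => ?_)
    (SublinearOperator.ae_ne_top_of_eLpNorm_top _)
  · rw [Real.enorm_eq_ofReal ht.1.le]
    exact ENNReal.mul_inv_cancel (ENNReal.ofReal_pos.mpr ht.1).ne' ENNReal.ofReal_ne_top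
  · rw [eLpNorm_exponent_top]
    exact essSup_copsonFun g

end WeightedL1

/-! ### Embedding bounded sequences into `L⁰(I)` -/

section BoundedSequences

variable {I : BaseInterval}

variable (I) in
/-- The map from bounded sequences to `L⁰(I)` which, on a set `s`, takes the value of the sequence
at an index depending measurably on the point. -/
def sequenceToL0 {s : Set ℝ} (hs : MeasurableSet s) {κ : ℝ → ℕ} (hκ : Measurable κ) :
    (ℕ →ᵇ ℝ) →ₗ[ℝ] I.L0 :=
  linearToL0 (fun x => s.indicator fun t => x (κ t))
    (fun x => (((measurable_of_countable x).comp hκ).indicator hs).aestronglyMeasurable)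
    (fun _ _ => ae_of_all _ fun t => congrFun (indicator_add s _ _) t)
    (fun _ _ => ae_of_all _ fun t => indicator_const_mul s _ _ t)

theorem coeFn_sequenceToL0 {s : Set ℝ} (hs : MeasurableSet s) {κ : ℝ → ℕ} (hκ : Measurable κ)
    (x : ℕ →ᵇ ℝ) :
    sequenceToL0 I hs hκ x =ᵐ[I.measure] s.indicator fun t => x (κ t) :=
  AEEqFun.coeFn_mk _ _

theorem enorm_sequenceToL0_le {s : Set ℝ} (hs : MeasurableSet s) {κ : ℝ → ℕ} (hκ : Measurable κ)
    (x : ℕ →ᵇ ℝ) :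
    ∀ᵐ t ∂I.measure, ‖sequenceToL0 I hs hκ x t‖ₑ ≤ ENNReal.ofReal ‖x‖ := by
  filter_upwards [coeFn_sequenceToL0 hs hκ x] with t ht
  rw [ht]
  by_cases h : t ∈ s
  · rw [indicator_of_mem h, ← ofReal_norm]
    exact ENNReal.ofReal_le_ofReal (x.norm_coe_le_norm _)
  · rw [indicator_of_notMem h, enorm_zero]
    exact zero_le

theorem ofReal_norm_le_of_forall_enorm_le (x : ℕ →ᵇ ℝ) {S : ℝ≥0∞} (h : ∀ n, ‖x n‖ₑ ≤ S) :
    ENNReal.ofReal ‖x‖ ≤ S := by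
  rcases eq_or_ne S ∞ with rfl | hS
  · exact le_top
  · refine ENNReal.ofReal_le_of_le_toReal ?_
    refine (BoundedContinuousFunction.norm_le ENNReal.toReal_nonneg).mpr fun n => ?_
    rw [← toReal_enorm]
    exact ENNReal.toReal_mono hS (h n)

theorem exists_mem_Ioo_of_ae_restrict {c d : ℝ} (hcd : c < d) {s : Set ℝ} (hs : Ioo c d ⊆ s)
    {P : ℝ → Prop} (h : ∀ᵐ t ∂volume.restrict s, P t) : ∃ t ∈ Ioo c d, P t := by
  have h3 : (volume.restrict (Ioo c d)) ≠ 0 := by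
    rw [Ne, Measure.restrict_eq_zero, Real.volume_Ioo]
    simp [hcd]
  have : (ae (volume.restrict (Ioo c d))).NeBot := ae_neBot.mpr h3
  exact ((ae_restrict_mem measurableSet_Ioo).and
    (ae_mono (Measure.restrict_mono_set volume hs) h)).exists

end BoundedSequences

/-! ### Bounded sequences in `Ces_∞` -/

section CesaroTop

variable {I : BaseInterval}

/-- The index of the block `(exp(-(k+1)²), exp(-k²)]`, where every value is taken by infinitely
many blocks. -/
def logIndex (t : ℝ) : ℕ := (Nat.unpair ⌊√(Real.log t⁻¹)⌋₊).1

theorem measurable_logIndex : Measurable logIndex :=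
  (measurable_from_nat (f := fun k => (Nat.unpair k).1)).comp
    (Nat.measurable_floor.comp (Real.measurable_log.comp measurable_inv).sqrt)

theorem logIndex_eq {n j : ℕ} {t : ℝ} (h1 : Real.exp (-((Nat.pair n j : ℝ) + 1) ^ 2) < t)
    (h2 : t ≤ Real.exp (-(Nat.pair n j : ℝ) ^ 2)) : logIndex t = n := by
  have h0 : 0 < t := (Real.exp_pos _).trans h1
  have h3 : ⌊√(Real.log t⁻¹)⌋₊ = Nat.pair n j := by
    rw [Nat.floor_eq_iff (Real.sqrt_nonneg _), Real.log_inv]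
    have h4 := (Real.lt_log_iff_exp_lt h0).mpr h1
    have h5 := (Real.log_le_iff_le_exp h0).mpr h2
    exact ⟨Real.le_sqrt_of_sq_le (by linarith),
      (Real.sqrt_lt' (by positivity)).mpr (by linarith)⟩
  unfold logIndex
  rw [h3, Nat.unpair_pair]

theorem cesaroFun_le_of_ae_le (g : I.L0) {C : ℝ≥0∞} (h : ∀ᵐ t ∂I.measure, ‖g t‖ₑ ≤ C) {y : ℝ}
    (hy : 0 < y) : cesaroFun g y ≤ C := by
  have h1 : ∫⁻ t in I.toSet ∩ Icc 0 y, ‖g t‖ₑ ≤ C * ENNReal.ofReal y := by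
    calc ∫⁻ t in I.toSet ∩ Icc 0 y, ‖g t‖ₑ ≤ ∫⁻ _ in I.toSet ∩ Icc 0 y, C :=
          lintegral_mono_ae (ae_mono (Measure.restrict_mono_set volume inter_subset_left) h)
      _ = C * volume (I.toSet ∩ Icc 0 y) := setLIntegral_const _ _
      _ ≤ C * volume (Icc 0 y) := by gcongr; exact inter_subset_right
      _ = C * ENNReal.ofReal y := by rw [Real.volume_Icc, sub_zero]
  unfold cesaroFun
  calc (ENNReal.ofReal y)⁻¹ * ∫⁻ t in I.toSet ∩ Icc 0 y, ‖g t‖ₑ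
      ≤ (ENNReal.ofReal y)⁻¹ * (C * ENNReal.ofReal y) := by gcongr
    _ = C := by
      rw [mul_left_comm, ENNReal.inv_mul_cancel (ENNReal.ofReal_pos.mpr hy).ne'
        ENNReal.ofReal_ne_top, mul_one]

/-- Discarding the integral over `[0,a]` costs the fraction `a / y` of the average. -/
theorem le_cesaroFun_of_ae_eq (g : I.L0) {C : ℝ≥0∞} {a y : ℝ} (ha : 0 ≤ a) (hy : 0 < y)
    (hyI : y ∈ I.toSet) (h : ∀ᵐ t ∂I.measure, t ∈ Ioc a y → ‖g t‖ₑ = C) :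
    C * ENNReal.ofReal (1 - a / y) ≤ cesaroFun g y := by
  have hsub : Ioc a y ⊆ I.toSet ∩ Icc 0 y := fun t ht =>
    ⟨Icc_subset_toSet hyI ⟨ha.trans ht.1.le, ht.2⟩, ha.trans ht.1.le, ht.2⟩
  have h1 : C * ENNReal.ofReal (y - a) ≤ ∫⁻ t in I.toSet ∩ Icc 0 y, ‖g t‖ₑ := by
    calc C * ENNReal.ofReal (y - a) = ∫⁻ _ in Ioc a y, C := by
          rw [setLIntegral_const, Real.volume_Ioc]
      _ = ∫⁻ t in Ioc a y, ‖g t‖ₑ := by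
          apply lintegral_congr_ae
          filter_upwards [ae_restrict_mem measurableSet_Ioc,
            ae_mono (Measure.restrict_mono_set volume (hsub.trans inter_subset_left)) h]
            with t h2 h3
          exact (h3 h2).symm
      _ ≤ _ := lintegral_mono_set hsub
  unfold cesaroFun
  refine le_trans (le_of_eq ?_) (mul_le_mul_right h1 _)
  have h2 : 1 - a / y = y⁻¹ * (y - a) := by field_simp
  rw [h2, ENNReal.ofReal_mul (inv_pos.mpr hy).le, ENNReal.ofReal_inv_of_pos hy, mul_left_comm]

/-- The ratio of the endpoints of the `k`-th block is `exp (-(2k+1))`, which tends to `0`. Near the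
right end of a far block with value `x n` the average is thus almost at least `|x n|`, and such
blocks exist for each `n`. -/
theorem essSup_cesaroFun_sequenceToL0 (x : ℕ →ᵇ ℝ) :
    essSup (cesaroFun (sequenceToL0 I (measurableSet_Ioc (a := (0 : ℝ)) (b := 1))
      measurable_logIndex x)) I.measure = ENNReal.ofReal ‖x‖ := by
  set g := sequenceToL0 I (measurableSet_Ioc (a := (0 : ℝ)) (b := 1)) measurable_logIndex x
    with hg
  apply le_antisymm
  · refine essSup_le_of_ae_le _ ?_
    filter_upwards [I.ae_pos] with y hy
    exact cesaroFun_le_of_ae_le g (enorm_sequenceToL0_le _ _ x) hy.1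
  · refine ofReal_norm_le_of_forall_enorm_le x fun n => ?_
    -- The loss `2 * exp (-j)` bounds `a / y`: the endpoint ratio is at most `exp (-j)` because `j ≤
    -- k`, and the factor `2` comes from `y` lying only beyond half the right endpoint.
    have hlim : Tendsto (fun j : ℕ => ‖x n‖ₑ * ENNReal.ofReal (1 - 2 * Real.exp (-(j : ℝ))))
        atTop (𝓝 (‖x n‖ₑ * ENNReal.ofReal (1 - 2 * 0))) := by
      refine ENNReal.Tendsto.const_mul ?_ (Or.inr enorm_ne_top)
      refine ENNReal.tendsto_ofReal (tendsto_const_nhds.sub (Tendsto.const_mul 2 ?_))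
      exact Real.tendsto_exp_neg_atTop_nhds_zero.comp tendsto_natCast_atTop_atTop
    rw [mul_zero, sub_zero, ENNReal.ofReal_one, mul_one] at hlim
    refine le_of_tendsto' hlim fun j => ?_
    set k : ℝ := (Nat.pair n j : ℝ) with hk
    have hjk : (j : ℝ) ≤ k := Nat.cast_le.mpr (Nat.right_le_pair n j)
    have hk0 : 0 ≤ k := Nat.cast_nonneg _
    have hb1 : Real.exp (-k ^ 2) ≤ 1 := Real.exp_le_one_iff.mpr (by nlinarith)
    have hb0 := Real.exp_pos (-k ^ 2)
    have hsub : Ioo (Real.exp (-k ^ 2) / 2) (Real.exp (-k ^ 2)) ⊆ I.toSet := fun t ht =>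
      Ioc_subset_toSet ⟨(half_pos hb0).trans ht.1, ht.2.le.trans hb1⟩
    -- The essential supremum bounds only almost every value, so `y` is chosen from an interval of
    -- positive length.
    obtain ⟨y, hy, hyS⟩ := exists_mem_Ioo_of_ae_restrict (half_lt_self hb0) hsub
      (ENNReal.ae_le_essSup (μ := I.measure) (cesaroFun g))
    have hy0 : 0 < y := (half_pos hb0).trans hy.1
    refine le_trans ?_ ((le_cesaroFun_of_ae_eq g (C := ‖x n‖ₑ)
      (Real.exp_pos (-(k + 1) ^ 2)).le hy0 (hsub hy) ?_).trans hyS)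
    · gcongr
      rw [div_le_iff₀ hy0]
      have h1 : Real.exp (-(k + 1) ^ 2) ≤ Real.exp (-(j : ℝ)) * Real.exp (-k ^ 2) := by
        rw [← Real.exp_add]
        exact Real.exp_le_exp.mpr (by nlinarith)
      have h2 := mul_le_mul_of_nonneg_left hy.1.le (Real.exp_pos (-(j : ℝ))).le
      linarith
    · filter_upwards [coeFn_sequenceToL0 measurableSet_Ioc measurable_logIndex x] with t h1 h2
      have h3 : t ∈ Ioc (0 : ℝ) 1 :=
        ⟨(Real.exp_pos _).trans h2.1, h2.2.trans (hy.2.le.trans hb1)⟩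
      rw [hg, h1, indicator_of_mem h3, logIndex_eq h2.1 (h2.2.trans hy.2.le)]

theorem not_weakFixedPointProperty_Ces_top (I : BaseInterval) :
    ¬ WeakFixedPointProperty (Ces I ∞) := by
  have h : ∀ x, eLpNorm ((cesaro I).toFun (sequenceToL0 I measurableSet_Ioc
      measurable_logIndex x)) ∞ I.measure = ENNReal.ofReal ‖x‖ := fun x => by
    rw [eLpNorm_exponent_top]
    exact essSup_cesaroFun_sequenceToL0 x
  exact (cesaro I).not_weakFixedPointProperty_domain_lebesgueSpace
    (not_weakFixedPointProperty_bounded_sequences not_weakFixedPointProperty_L1_circle) ∞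
    (sequenceToL0 I measurableSet_Ioc measurable_logIndex)
    (fun x => (cesaro I).ae_ne_top_of_eLpNorm_top _ (by rw [h]; exact ENNReal.ofReal_ne_top)) h

end CesaroTop

/-! ### Bounded sequences in Tandori spaces -/

section Tandori

variable {I : BaseInterval}

/-- The index of a block of points accumulating at `a` from the left, where every value is taken
by infinitely many blocks. -/
def leftIndex (a t : ℝ) : ℕ := (Nat.unpair ⌊(a - t)⁻¹⌋₊).1

theorem measurable_leftIndex (a : ℝ) : Measurable (leftIndex a) :=
  (measurable_from_nat (f := fun k => (Nat.unpair k).1)).comp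
    (Nat.measurable_floor.comp (measurable_const.sub measurable_id).inv)

/-- Between `a - 1/k` and `a - 1/(k+1)` the floor of `1/(a - t)` is `k`. Taking `k = Nat.pair n j`
with `j > 1/(a - y)` gives index `n` and puts the block to the right of `y`. -/
theorem exists_Ioo_leftIndex_eq {a y : ℝ} (hy : y < a) (n : ℕ) :
    ∃ c d, c < d ∧ Ioo c d ⊆ Ico y a ∧ ∀ t ∈ Ioo c d, leftIndex a t = n := by
  obtain ⟨j, hj⟩ := exists_nat_gt (a - y)⁻¹
  have hjk : (j : ℝ) ≤ (Nat.pair n j : ℝ) := by exact_mod_cast Nat.right_le_pair n j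
  set k : ℝ := (Nat.pair n j : ℝ) with hk
  have hay : 0 < (a - y)⁻¹ := inv_pos.mpr (sub_pos.mpr hy)
  have hk0 : 0 < k := hay.trans (hj.trans_le hjk)
  have h1 : k⁻¹ < a - y := inv_lt_of_inv_lt₀ (sub_pos.mpr hy) (hj.trans_le hjk)
  have h2 : (k + 1)⁻¹ < k⁻¹ := inv_strictAnti₀ hk0 (by linarith)
  have h3 : 0 < (k + 1)⁻¹ := by positivity
  refine ⟨a - k⁻¹, a - (k + 1)⁻¹, by linarith, fun t ht => ⟨by linarith [ht.1], by
    linarith [ht.2]⟩, fun t ht => ?_⟩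
  have h4 : 0 < a - t := by linarith [ht.2]
  have h5 : ⌊(a - t)⁻¹⌋₊ = Nat.pair n j := by
    rw [Nat.floor_eq_iff (inv_pos.mpr h4).le]
    exact ⟨(le_inv_comm₀ hk0 h4).mpr (by linarith [ht.1]),
      (inv_lt_comm₀ h4 (by positivity)).mpr (by linarith [ht.2])⟩
  unfold leftIndex
  rw [h5, Nat.unpair_pair]

/-- Every term of `x` is attained on positive measure arbitrarily close to the left of `a`, so all
tails starting before `a` have the same supremum `‖x‖`; beyond `a` the function vanishes. -/
theorem tandoriFun_sequenceToL0 {a : ℝ} (ha : a ∈ I.toSet) (x : ℕ →ᵇ ℝ) {y : ℝ} (hy : 0 ≤ y) :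
    tandoriFun (sequenceToL0 I (measurableSet_Ico (a := (0 : ℝ)) (b := a))
      (measurable_leftIndex a) x) y = ENNReal.ofReal (‖x‖ * (Ico 0 a).indicator 1 y) := by
  set g := sequenceToL0 I (measurableSet_Ico (a := (0 : ℝ)) (b := a)) (measurable_leftIndex a) x
    with hg
  have hle : I.toSet ∩ Ici y ⊆ I.toSet := inter_subset_left
  have hco : g =ᵐ[volume.restrict (I.toSet ∩ Ici y)] _ :=
    coe_ae_congr_of_le (coeFn_sequenceToL0 measurableSet_Ico (measurable_leftIndex a) x) hle
  rcases lt_or_ge y a with hya | hya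
  · rw [indicator_of_mem (show y ∈ Ico 0 a from ⟨hy, hya⟩), Pi.one_apply, mul_one]
    apply le_antisymm
    · exact essSup_le_of_ae_le _ (ae_mono (Measure.restrict_mono_set volume hle)
        (enorm_sequenceToL0_le _ _ x))
    · refine ofReal_norm_le_of_forall_enorm_le x fun n => ?_
      obtain ⟨c, d, hcd, hsub, hn⟩ := exists_Ioo_leftIndex_eq hya n
      have hsub2 : Ioo c d ⊆ I.toSet ∩ Ici y := fun t ht =>
        ⟨Icc_subset_toSet ha ⟨hy.trans (hsub ht).1, (hsub ht).2.le⟩, (hsub ht).1⟩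
      obtain ⟨t, ht, h1, h2⟩ := exists_mem_Ioo_of_ae_restrict hcd hsub2
        (hco.and (ENNReal.ae_le_essSup fun t => ‖g t‖ₑ))
      rw [h1, indicator_of_mem (show t ∈ Ico 0 a from ⟨hy.trans (hsub ht).1, (hsub ht).2⟩),
        hn t ht] at h2
      exact h2
  · rw [indicator_of_notMem (fun h => h.2.not_ge hya), mul_zero, ENNReal.ofReal_zero]
    refine ENNReal.essSup_eq_zero_iff.mpr ?_
    filter_upwards [hco, ae_restrict_mem (I.measurableSet_toSet.inter measurableSet_Ici)]
      with t h1 h2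
    rw [h1, indicator_of_notMem (fun h => h.2.not_ge (hya.trans h2.2)), enorm_zero]
    rfl

theorem antitone_tandoriFun (f : I.L0) : Antitone (tandoriFun f) := fun _ _ hxy =>
  essSup_mono_measure' (Measure.restrict_mono_set volume
    (inter_subset_inter_right _ (Ici_subset_Ici.mpr hxy)))

variable (I) in
/-- The class of the indicator function of `[0,a)`. -/
def initialIndicator (a : ℝ) : I.L0 :=
  AEEqFun.mk ((Ico 0 a).indicator 1)
    ((measurable_one.indicator measurableSet_Ico).aestronglyMeasurable)

theorem coeFn_initialIndicator (a : ℝ) :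
    initialIndicator I a =ᵐ[I.measure] (Ico 0 a).indicator 1 :=
  AEEqFun.coeFn_mk _ _

theorem initialIndicator_ne_zero {a : ℝ} (h0 : 0 < a) (ha : a ∈ I.toSet) :
    initialIndicator I a ≠ 0 := by
  intro h
  have h1 := coeFn_initialIndicator (I := I) a
  rw [h] at h1
  have hsub : Ioo 0 a ⊆ I.toSet := fun t ht => Icc_subset_toSet ha ⟨ht.1.le, ht.2.le⟩
  obtain ⟨t, ht, h2, h3⟩ := exists_mem_Ioo_of_ae_restrict h0 hsub
    (h1.and (AEEqFun.coeFn_zero (β := ℝ) (μ := I.measure)))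
  rw [h3, indicator_of_mem (show t ∈ Ico 0 a from ⟨ht.1.le, ht.2⟩)] at h2
  exact zero_ne_one h2

/-- Take a nonzero `f` and a point `a` where its majorant has a finite positive value `c`. The
majorant is nonincreasing, hence at least `c` on `[0,a)`, and the ideal property applies to `c⁻¹`
times it. -/
theorem exists_initialIndicator_mem (X : BanachFunctionSpace I) [Nontrivial (TandoriSpace X)] :
    ∃ a, 0 < a ∧ a ∈ I.toSet ∧ initialIndicator I a ∈ X.toSubmodule := by
  obtain ⟨f, hf⟩ := exists_ne (0 : TandoriSpace X)
  have hf1 : f.1 ≠ 0 := fun h => hf (Subtype.ext h)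
  have hfreq : ∃ᵐ x ∂I.measure, tandoriFun f.1 x ≠ 0 := fun h =>
    hf1 ((tandori I).eq_zero f.1 (h.mono fun x hx => not_not.mp hx))
  obtain ⟨a, ha, ⟨ha0, haI⟩, hatop⟩ := (hfreq.and_eventually (I.ae_pos.and f.2.1)).exists
  have hc : 0 < (tandoriFun f.1 a).toReal := ENNReal.toReal_pos ha hatop
  refine ⟨a, ha0, haI, X.ideal_mem _ ((tandoriFun f.1 a).toReal⁻¹ • (tandori I).toL0 f.1) ?_
    (X.toSubmodule.smul_mem _ f.2.2)⟩
  filter_upwards [coeFn_initialIndicator (I := I) a, (tandori I).coe_toL0 f.1,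
    AEEqFun.coeFn_smul (tandoriFun f.1 a).toReal⁻¹ ((tandori I).toL0 f.1), f.2.1] with x h1 h2 h3 h4
  rw [h1, h3, Pi.smul_apply, h2]
  by_cases hx : x ∈ Ico 0 a
  · rw [indicator_of_mem hx, Pi.one_apply, abs_one, smul_eq_mul, abs_of_nonneg
      (mul_nonneg (inv_pos.mpr hc).le ENNReal.toReal_nonneg), ← div_eq_inv_mul, one_le_div hc]
    exact ENNReal.toReal_mono h4 (antitone_tandoriFun f.1 hx.2.le)
  · rw [indicator_of_notMem hx, abs_zero]
    exact abs_nonneg _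

theorem toL0_tandori_sequenceToL0 {a : ℝ} (ha : a ∈ I.toSet) (x : ℕ →ᵇ ℝ) :
    (tandori I).toL0 (sequenceToL0 I (measurableSet_Ico (a := (0 : ℝ)) (b := a))
      (measurable_leftIndex a) x) = ‖x‖ • initialIndicator I a := by
  apply AEEqFun.ext
  filter_upwards [(tandori I).coe_toL0 (sequenceToL0 I (measurableSet_Ico (a := (0 : ℝ)) (b := a))
      (measurable_leftIndex a) x), AEEqFun.coeFn_smul ‖x‖ (initialIndicator I a),
    coeFn_initialIndicator (I := I) a, I.ae_pos] with y h1 h2 h3 h4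
  rw [h1, h2, Pi.smul_apply, h3, smul_eq_mul]
  change (tandoriFun _ y).toReal = _
  rw [tandoriFun_sequenceToL0 ha x h4.1.le, ENNReal.toReal_ofReal]
  exact mul_nonneg (norm_nonneg x) (indicator_nonneg (fun _ _ => zero_le_one) y)

theorem not_weakFixedPointProperty_tandoriSpace (X : BanachFunctionSpace I)
    [Nontrivial (TandoriSpace X)] : ¬ WeakFixedPointProperty (TandoriSpace X) := by
  obtain ⟨a, ha0, haI, hmem⟩ := exists_initialIndicator_mem X
  have hpos : 0 < X.norm ⟨initialIndicator I a, hmem⟩ := by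
    refine lt_of_le_of_ne (X.norm_nonneg _) fun h => ?_
    exact initialIndicator_ne_zero ha0 haI (congrArg Subtype.val (X.norm_eq_zero _ h.symm))
  refine (tandori I).not_weakFixedPointProperty_domain
    (not_weakFixedPointProperty_bounded_sequences not_weakFixedPointProperty_L1_circle) X
    (sequenceToL0 I (measurableSet_Ico (a := (0 : ℝ)) (b := a)) (measurable_leftIndex a)) hpos (fun x => ?_) (fun x => ?_)
    (fun x => ?_)
  · filter_upwards [I.ae_pos] with y hy
    change tandoriFun _ y ≠ ∞
    rw [tandoriFun_sequenceToL0 haI x hy.1.le]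
    exact ENNReal.ofReal_ne_top
  · rw [toL0_tandori_sequenceToL0 haI]
    exact X.toSubmodule.smul_mem _ hmem
  · have h : ∀ u (hu : u ∈ X.toSubmodule), u = ‖x‖ • initialIndicator I a →
        X.norm ⟨u, hu⟩ = X.norm ⟨initialIndicator I a, hmem⟩ * ‖x‖ := by
      rintro _ hu rfl
      have h1 := X.norm_smul ‖x‖ ⟨initialIndicator I a, hmem⟩
      rw [abs_norm, mul_comm] at h1
      exact h1
    exact h _ _ (toL0_tandori_sequenceToL0 haI x)

end Tandori

end

theorem proposition7p5 :
    ¬ WeakFixedPointProperty (Ces BaseInterval.unit 1) ∧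
    (∀ I : BaseInterval, ¬ WeakFixedPointProperty (Ces I ∞)) ∧
    (∀ I : BaseInterval, ¬ WeakFixedPointProperty (Cop I 1)) ∧
    (∀ I : BaseInterval, ¬ WeakFixedPointProperty (Cop I ∞)) ∧
    (∀ (I : BaseInterval) (X : BanachFunctionSpace I), Nontrivial (TandoriSpace X) →
      ¬ WeakFixedPointProperty (TandoriSpace X)) := by
  refine ⟨not_weakFixedPointProperty_Ces_unit_one, not_weakFixedPointProperty_Ces_top,
    not_weakFixedPointProperty_Cop_one, not_weakFixedPointProperty_Cop_top, fun I X hX => ?_⟩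
  exact not_weakFixedPointProperty_tandoriSpace X
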